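/- Let $k$ be a field of characteristic zero, $\Omega$ a nonempty set, and $M=\{M(n)\}_{n\ge 0}$ an $\mathbb S$-module over $k$ (right $k[S_n]$-modules $M(n)$) with $M(0)=0$. Let $\mathcal T(M)$ be the free symmetric operad on $M$, and let $\mathcal T(M)^{(m)}$ be the span of the decorated trees with $m\ge 0$ internal vertices. An element of $\mathcal T(M)^{(m)}(n)$ is called homogeneous of weight $m$. Let $R=\{R(n)\}$, $R(n)\subseteq\mathcal T(M)(n)$, be relations such that the operad $\mathcal P=\mathcal T(M)/\langle R\rangle$ is locally homogeneous, that is, the operadic ideal $\langle R\rangle$ is generated by the homogeneous elements of $R$. Let $M_\omega$ ($\omega\in\Omega$) be copies of $M$, with $x_\omega\in M_\omega$ the copy of $x\in M$. For $f\in\mathcal T(M)^{(m)}(n)$ and $c=(c_\omega)_{\omega\in\Omega}$ with $c_\omega\in\mathbb Z_{\ge 0}$, $\sum_\omega c_\omega=m$, the quasipolarization $f_c\in\mathcal T(\bigoplus_\omega M_\omega)(n)$ is the coefficient of $\prod_\omega\lambda_\omega^{c_\omega}$ in the formal expansion of $f|_{x\mapsto\sum_\omega\lambda_\omega x_\omega}$,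 with formal variables $\lambda_\omega$. Let $$\mathrm{Lin}\,\mathcal P_\Omega=\mathcal T\Big(\bigoplus_{\omega\in\Omega}M_\omega\Big)\Big/\big\langle\, r_c \;\big|\; r\in R \text{ homogeneous},\ \textstyle\sum_\omega c_\omega=\text{weight of } r\,\big\rangle .$$ For an operad $\mathcal Q$, a $\mathcal Q$-algebra structure on a $k$-vector space $V$ is a morphism of operads $\mathcal Q\to\mathrm{End}_V$. A family of operations given by an $\mathbb S$-module morphism $\nu:M\to\mathrm{End}_V$ makes $V$ a $\mathcal P$-algebra if some morphism of operads $\mathcal P\to\mathrm{End}_V$ sends the class of each $x\in M$ to $\nu(x)$. Replicated operations $\mu=(\mu_\omega:M\to\mathrm{End}_V)_{\omega\in\Omega}$ make $V$ an $\Omega$-linearly compatible $\mathcal P$-algebra if each $\mu_\omega$ makes $V$ a $\mathcal P$-algebra and, for all scalars $(a_\omega)_{\omega\in\Omega}$ in $k$ with only finitely many nonzero, $\sum_\omega a_\omega\mu_\omega$ also makes $V$ a $\mathcal P$-algebra. **Theorem.** Let $V$ be a $k$-vector space. Assigning to a $\mathrm{Lin}\,\mathcal P_\Omega$-algebra structure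 $\rho:\mathrm{Lin}\,\mathcal P_\Omega\to\mathrm{End}_V$ the replicated operations $\mu_\omega(x)=\rho([x_\omega])$ is injective, and a family $\mu=(\mu_\omega)_{\omega\in\Omega}$ of $\mathbb S$-module morphisms $M\to\mathrm{End}_V$ arises in this way from a $\mathrm{Lin}\,\mathcal P_\Omega$-algebra structure if and only if it makes $V$ an $\Omega$-linearly compatible $\mathcal P$-algebra. In other words, a $\mathrm{Lin}\,\mathcal P_\Omega$-algebra is the same as an $\Omega$-linearly compatible $\mathcal P$-algebra. -/

import Mathlib

universe u v w x

/-! ## Symmetric modules and symmetric operads over a field -/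

/-- An `𝕊`-module over `k`: a family of `k`-vector spaces `M n`, `n ≥ 0`, with a linear right action
of the symmetric group `Perm (Fin n)` on `M n`; `act n σ x` is `x · σ`. -/
structure SModule (k : Type u) [Field k] where
  carrier : ℕ → Type v
  [instAddCommGroup : ∀ n, AddCommGroup (carrier n)]
  [instModule : ∀ n, Module k (carrier n)]
  act : ∀ n, Equiv.Perm (Fin n) → (carrier n →ₗ[k] carrier n)
  act_one : ∀ n (x : carrier n), act n 1 x = x
  act_mul : ∀ n (σ τ : Equiv.Perm (Fin n)) (x : carrier n),
    act n (σ * τ) x = act n τ (act n σ x)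

attribute [instance] SModule.instAddCommGroup SModule.instModule

namespace SModule

variable {k : Type u} [Field k]

instance : CoeFun (SModule.{u, v} k) (fun _ => ℕ → Type v) := ⟨SModule.carrier⟩

/-- `M` is reduced if `M(0) = 0`. -/
def IsReduced (M : SModule.{u, v} k) : Prop := ∀ x : M 0, x = 0

/-- The identification `M n = M m` when `n = m`. -/
def castMap (M : SModule.{u, v} k) {n m : ℕ} (h : n = m) : M n →ₗ[k] M m := h ▸ LinearMap.id

/-- Transport along a bijection `e : Fin n ≃ Fin m` (which forces `n = m`). For a permutation `σ`
of `Fin n` this is the action of `σ⁻¹`, see `relabel_perm`. -/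
def relabel (M : SModule.{u, v} k) {n m : ℕ} (e : Fin n ≃ Fin m) : M n →ₗ[k] M m :=
  have h : n = m := Fin.equiv_iff_eq.mp ⟨e⟩
  (M.castMap h).comp (M.act n (e.trans (finCongr h.symm))⁻¹)

theorem relabel_perm (M : SModule.{u, v} k) {n : ℕ} (σ : Equiv.Perm (Fin n)) (x : M n) :
    M.relabel σ x = M.act n σ⁻¹ x := rfl

theorem relabel_refl (M : SModule.{u, v} k) {n : ℕ} (x : M n) :
    M.relabel (Equiv.refl (Fin n)) x = x := M.act_one n x

theorem relabel_trans (M : SModule.{u, v} k) {n m l : ℕ} (e : Fin n ≃ Fin m) (f : Fin m ≃ Fin l)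
    (x : M n) : M.relabel (e.trans f) x = M.relabel f (M.relabel e x) := by
  obtain rfl : n = m := Fin.equiv_iff_eq.mp ⟨e⟩
  obtain rfl : n = l := Fin.equiv_iff_eq.mp ⟨f⟩
  have h : (e.trans f : Equiv.Perm (Fin n))⁻¹ = e⁻¹ * f⁻¹ := rfl
  rw [relabel_perm, relabel_perm, relabel_perm, h, act_mul]

end SModule

/-- A morphism of `𝕊`-modules: linear equivariant maps `M n → N n`. -/
@[ext]
structure SModuleHom {k : Type u} [Field k] (M : SModule.{u, v} k) (N : SModule.{u, w} k) where
  toFun : ∀ n, M n →ₗ[k] N n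
  map_act : ∀ n (σ : Equiv.Perm (Fin n)) (x : M n),
    toFun n (M.act n σ x) = N.act n σ (toFun n x)

theorem SModuleHom.map_relabel {k : Type u} [Field k] {M : SModule.{u, v} k} {N : SModule.{u, w} k}
    (φ : SModuleHom M N) {n m : ℕ} (e : Fin n ≃ Fin m) (x : M n) :
    φ.toFun m (M.relabel e x) = N.relabel e (φ.toFun n x) := by
  obtain rfl : n = m := Fin.equiv_iff_eq.mp ⟨e⟩
  rw [SModule.relabel_perm, SModule.relabel_perm, φ.map_act]

/-! Positions in a composite. The inputs of `γ(f; g₁, …, g_r)` with `g_i` of arity `n i` are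
numbered by `Fin (∑ i, n i)`, the input `j` of `g_i` having the number `finSigmaFinEquiv ⟨i, j⟩`. -/

/-- The direct sum permutation `τ₁ ⊕ ⋯ ⊕ τ_r`. -/
def sumPerm {r : ℕ} {n : Fin r → ℕ} (τ : ∀ i, Equiv.Perm (Fin (n i))) :
    Equiv.Perm (Fin (∑ i, n i)) :=
  finSigmaFinEquiv.permCongr (Equiv.sigmaCongrRight τ)

/-- The block permutation: input `j` of block `i` of `(n (σ⁻¹ i))_i` goes to input `j` of block
`σ⁻¹ i` of `(n i)_i`. -/
def blockEquiv {r : ℕ} (σ : Equiv.Perm (Fin r)) (n : Fin r → ℕ) :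
    Fin (∑ i, n (σ⁻¹ i)) ≃ Fin (∑ i, n i) :=
  finSigmaFinEquiv.symm.trans
    ((Equiv.sigmaCongrLeft (β := fun i => Fin (n i)) σ⁻¹).trans finSigmaFinEquiv)

/-- The order preserving identification of the inputs of `γ(γ(f; g_i); h_{ij})` with those of
`γ(f; γ(g_i; h_{ij}))`. -/
def assocEquiv {r : ℕ} (n : Fin r → ℕ) (m : ∀ i, Fin (n i) → ℕ) :
    Fin (∑ l : Fin (∑ i, n i), m (finSigmaFinEquiv.symm l).1 (finSigmaFinEquiv.symm l).2) ≃
      Fin (∑ i, ∑ j, m i j) :=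
  (finSigmaFinEquiv.symm.trans
    (Equiv.sigmaCongrLeft (β := fun p : (Σ i, Fin (n i)) => Fin (m p.1 p.2))
      finSigmaFinEquiv.symm)).trans
    ((Equiv.sigmaAssoc fun i (j : Fin (n i)) => Fin (m i j)).trans
      ((Equiv.sigmaCongrRight fun _ => finSigmaFinEquiv).trans finSigmaFinEquiv))

/-- The identification of the inputs of `γ(id; f)` with those of `f`. -/
def unitLeftEquiv (n : ℕ) : Fin (∑ _ : Fin 1, n) ≃ Fin n :=
  finSigmaFinEquiv.symm.trans (Equiv.uniqueSigma fun _ : Fin 1 => Fin n)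

/-- The identification of the inputs of `γ(f; id, …, id)` with those of `f`. -/
def unitRightEquiv (n : ℕ) : Fin (∑ _ : Fin n, 1) ≃ Fin n :=
  finSigmaFinEquiv.symm.trans (Equiv.sigmaUnique (Fin n) fun _ => Fin 1)

/-- A symmetric operad: an `𝕊`-module with an identity `id ∈ P(1)` and multilinear composition maps
`γ : P(r) ⊗ P(n₁) ⊗ ⋯ ⊗ P(n_r) → P(n₁ + ⋯ + n_r)` which are equivariant, associative and unital. -/
structure SymOperad (k : Type u) [Field k] extends SModule.{u, v} k where
  one : carrier 1
  gamma : ∀ {r : ℕ} (n : Fin r → ℕ),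
    carrier r →ₗ[k] MultilinearMap k (fun i => carrier (n i)) (carrier (∑ i, n i))
  gamma_act_inner : ∀ {r : ℕ} (n : Fin r → ℕ) (f : carrier r) (g : ∀ i, carrier (n i))
    (τ : ∀ i, Equiv.Perm (Fin (n i))),
    gamma n f (fun i => act (n i) (τ i) (g i)) = act _ (sumPerm τ) (gamma n f g)
  gamma_act_outer : ∀ {r : ℕ} (n : Fin r → ℕ) (f : carrier r) (g : ∀ i, carrier (n i))
    (σ : Equiv.Perm (Fin r)),
    gamma n (act r σ f) g =
      toSModule.relabel (blockEquiv σ n) (gamma (fun i => n (σ⁻¹ i)) f (fun i => g (σ⁻¹ i)))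
  gamma_assoc : ∀ {r : ℕ} (n : Fin r → ℕ) (m : ∀ i, Fin (n i) → ℕ) (f : carrier r)
    (g : ∀ i, carrier (n i)) (h : ∀ i j, carrier (m i j)),
    toSModule.relabel (assocEquiv n m)
        (gamma (fun l : Fin (∑ i, n i) =>
            m (finSigmaFinEquiv.symm l).1 (finSigmaFinEquiv.symm l).2)
          (gamma n f g)
          (fun l => h (finSigmaFinEquiv.symm l).1 (finSigmaFinEquiv.symm l).2)) =
      gamma (fun i => ∑ j, m i j) f (fun i => gamma (m i) (g i) (h i))
  gamma_one_left : ∀ {n : ℕ} (f : carrier n),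
    toSModule.relabel (unitLeftEquiv n) (gamma (fun _ : Fin 1 => n) one (fun _ => f)) = f
  gamma_one_right : ∀ {n : ℕ} (f : carrier n),
    toSModule.relabel (unitRightEquiv n) (gamma (fun _ : Fin n => 1) f (fun _ => one)) = f

instance {k : Type u} [Field k] : CoeFun (SymOperad.{u, v} k) (fun _ => ℕ → Type v) :=
  ⟨fun P => P.carrier⟩

/-- A morphism of operads. -/
@[ext]
structure OperadHom {k : Type u} [Field k] (P : SymOperad.{u, v} k) (Q : SymOperad.{u, w} k) extends
    SModuleHom P.toSModule Q.toSModule where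
  map_one : toFun 1 P.one = Q.one
  map_gamma : ∀ {r : ℕ} (n : Fin r → ℕ) (f : P r) (g : ∀ i, P (n i)),
    toFun _ (P.gamma n f g) = Q.gamma n (toFun r f) (fun i => toFun (n i) (g i))

/-! ## The endomorphism operad -/

/-- `End_V(n) = Hom(V^{⊗ n}, V)` with `(f · σ)(v₁, …, v_n) = f(v_{σ⁻¹(1)}, …, v_{σ⁻¹(n)})`. -/
def endSModule (k : Type u) [Field k] (V : Type v) [AddCommGroup V] [Module k V] :
    SModule.{u, v} k where
  carrier n := MultilinearMap k (fun _ : Fin n => V) V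
  act _ σ :=
    { toFun := fun f => f.domDomCongr σ⁻¹
      map_add' := fun _ _ => rfl
      map_smul' := fun _ _ => rfl }
  act_one _ _ := rfl
  act_mul _ _ _ _ := rfl

/-- Elements of `End_V(n)` as functions on `V^n`. -/
def endEval {k : Type u} [Field k] {V : Type v} [AddCommGroup V] [Module k V] {n : ℕ}
    (f : endSModule k V n) : (Fin n → V) → V :=
  (show MultilinearMap k (fun _ : Fin n => V) V from f)

theorem endEval_ext {k : Type u} [Field k] {V : Type v} [AddCommGroup V] [Module k V] {n : ℕ}
    {f g : endSModule k V n} (h : ∀ a, endEval f a = endEval g a) : f = g :=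
  MultilinearMap.ext h

theorem endEval_relabel {k : Type u} [Field k] {V : Type v} [AddCommGroup V] [Module k V]
    {n m : ℕ} (e : Fin n ≃ Fin m) (f : endSModule k V n) (a : Fin m → V) :
    endEval ((endSModule k V).relabel e f) a = endEval f (fun i => a (e i)) := by
  obtain rfl : n = m := Fin.equiv_iff_eq.mp ⟨e⟩
  rfl

theorem endEval_update {k : Type u} [Field k] {V : Type v} [AddCommGroup V] [Module k V] {r : ℕ}
    {n : Fin r → ℕ} [DecidableEq (Fin r)] (g : ∀ i, endSModule k V (n i)) (i : Fin r)
    (z : endSModule k V (n i)) (b : ∀ i, Fin (n i) → V) :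
    (fun i' => endEval (Function.update g i z i') (b i')) =
      Function.update (fun i' => endEval (g i') (b i')) i (endEval z (b i)) := by
  funext i'
  by_cases h : i' = i
  · subst h; simp
  · simp [h]

/-- `γ(f; g₁, …, g_r)` for multilinear maps: the usual composition, with the inputs of
`g₁, …, g_r` numbered consecutively. -/
def endGamma (k : Type u) [Field k] (V : Type v) [AddCommGroup V] [Module k V] {r : ℕ}
    (n : Fin r → ℕ) :
    endSModule k V r →ₗ[k]
      MultilinearMap k (fun i => endSModule k V (n i)) (endSModule k V (∑ i, n i)) where
  toFun f :=
    { toFun := fun g => MultilinearMap.domDomCongr finSigmaFinEquiv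
        (MultilinearMap.compMultilinearMap (R := k) (M₁ := fun _ => V) (β := fun i => Fin (n i))
          (N := fun _ _ => V) f g)
      map_update_add' := by
        intro _ g i x y
        refine endEval_ext fun a => ?_
        change endEval f (fun i' => endEval (Function.update g i (x + y) i')
              (fun j => a (finSigmaFinEquiv ⟨i', j⟩))) =
            endEval f (fun i' => endEval (Function.update g i x i')
              (fun j => a (finSigmaFinEquiv ⟨i', j⟩))) +
            endEval f (fun i' => endEval (Function.update g i y i')
              (fun j => a (finSigmaFinEquiv ⟨i', j⟩)))
        rw [endEval_update (b := fun i' j => a (finSigmaFinEquiv ⟨i', j⟩)),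
          endEval_update (b := fun i' j => a (finSigmaFinEquiv ⟨i', j⟩)),
          endEval_update (b := fun i' j => a (finSigmaFinEquiv ⟨i', j⟩))]
        exact MultilinearMap.map_update_add
          (show MultilinearMap k (fun _ : Fin r => V) V from f) _ _ _ _
      map_update_smul' := by
        intro _ g i c x
        refine endEval_ext fun a => ?_
        change endEval f (fun i' => endEval (Function.update g i (c • x) i')
              (fun j => a (finSigmaFinEquiv ⟨i', j⟩))) =
            c • endEval f (fun i' => endEval (Function.update g i x i')
              (fun j => a (finSigmaFinEquiv ⟨i', j⟩)))
        rw [endEval_update (b := fun i' j => a (finSigmaFinEquiv ⟨i', j⟩)),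
          endEval_update (b := fun i' j => a (finSigmaFinEquiv ⟨i', j⟩))]
        exact MultilinearMap.map_update_smul
          (show MultilinearMap k (fun _ : Fin r => V) V from f) _ _ _ _ }
  map_add' _ _ := rfl
  map_smul' _ _ := rfl

theorem endEval_gamma {k : Type u} [Field k] {V : Type v} [AddCommGroup V] [Module k V] {r : ℕ}
    (n : Fin r → ℕ) (f : endSModule k V r) (g : ∀ i, endSModule k V (n i))
    (a : Fin (∑ i, n i) → V) :
    endEval (endGamma k V n f g) a =
      endEval f (fun i => endEval (g i) (fun j => a (finSigmaFinEquiv ⟨i, j⟩))) := rfl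

theorem endEval_act {k : Type u} [Field k] {V : Type v} [AddCommGroup V] [Module k V] {n : ℕ}
    (σ : Equiv.Perm (Fin n)) (f : endSModule k V n) (a : Fin n → V) :
    endEval ((endSModule k V).act n σ f) a = endEval f (fun i => a (σ⁻¹ i)) := rfl

/-- The identity map of `V` as an element of `End_V(1)`. -/
def endOne (k : Type u) [Field k] (V : Type v) [AddCommGroup V] [Module k V] : endSModule k V 1 :=
  MultilinearMap.ofSubsingleton k V V (0 : Fin 1) LinearMap.id

theorem endEval_one {k : Type u} [Field k] {V : Type v} [AddCommGroup V] [Module k V]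
    (a : Fin 1 → V) : endEval (endOne k V) a = a 0 := rfl

/-- The endomorphism operad `End_V`. -/
def endOperad (k : Type u) [Field k] (V : Type v) [AddCommGroup V] [Module k V] :
    SymOperad.{u, v} k where
  toSModule := endSModule k V
  one := endOne k V
  gamma n := endGamma k V n
  gamma_act_inner n f g τ := by
    refine endEval_ext fun a => ?_
    rw [endEval_act, endEval_gamma, endEval_gamma]
    simp only [endEval_act]
    have h : ∀ i j, (sumPerm τ)⁻¹ (finSigmaFinEquiv ⟨i, j⟩)
        = finSigmaFinEquiv ⟨i, (τ i)⁻¹ j⟩ := by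
      intro i j
      rw [Equiv.Perm.inv_eq_iff_eq]
      simp [sumPerm]
    simp only [h]
  gamma_act_outer n f g σ := by
    refine endEval_ext fun a => ?_
    rw [endEval_relabel, endEval_gamma, endEval_gamma, endEval_act]
    simp [blockEquiv]
  gamma_assoc n m f g h := by
    refine endEval_ext fun a => ?_
    rw [endEval_relabel, endEval_gamma, endEval_gamma, endEval_gamma]
    simp only [endEval_gamma]
    congr 1
    funext i
    congr 1
    funext j
    have key : ∀ (p : Σ i, Fin (n i)) (q : Σ i, Fin (n i)) (hpq : q = p),
        endEval (h q.1 q.2) (fun t => a (finSigmaFinEquiv ⟨q.1, finSigmaFinEquiv ⟨q.2, t⟩⟩)) =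
        endEval (h p.1 p.2) (fun t => a (finSigmaFinEquiv ⟨p.1, finSigmaFinEquiv ⟨p.2, t⟩⟩)) := by
      rintro p q rfl
      rfl
    rw [← key ⟨i, j⟩ (finSigmaFinEquiv.symm (finSigmaFinEquiv ⟨i, j⟩)) (by simp)]
    congr 1
    funext t
    simp [assocEquiv, Equiv.sigmaAssoc, Equiv.sigmaCongrLeft]
  gamma_one_left f := by
    refine endEval_ext fun a => ?_
    rw [endEval_relabel, endEval_gamma, endEval_one]
    simp [unitLeftEquiv]
    rfl
  gamma_one_right f := by
    refine endEval_ext fun a => ?_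
    rw [endEval_relabel, endEval_gamma]
    simp only [endEval_one]
    congr 1
    funext i
    simp [unitRightEquiv]

/-! ## The free operad -/

/-- Formal operadic expressions in the elements of an `𝕊`-module `M`. -/
inductive FreeTerm {k : Type u} [Field k] (M : SModule.{u, v} k) : ℕ → Type (max u v)
  | gen {n : ℕ} (x : M n) : FreeTerm M n
  | one : FreeTerm M 1
  | gamma {r : ℕ} (n : Fin r → ℕ) (f : FreeTerm M r) (g : ∀ i, FreeTerm M (n i)) :
      FreeTerm M (∑ i, n i)
  | relabel {n m : ℕ} (e : Fin n ≃ Fin m) (t : FreeTerm M n) : FreeTerm M m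
  | zero {n : ℕ} : FreeTerm M n
  | add {n : ℕ} (s t : FreeTerm M n) : FreeTerm M n
  | smul {n : ℕ} (c : k) (t : FreeTerm M n) : FreeTerm M n

/-- The smallest congruence on formal expressions imposing the axioms of a symmetric operad and the
linearity and equivariance of `M n → T(M)(n)`. -/
inductive FreeRel {k : Type u} [Field k] {M : SModule.{u, v} k} :
    ∀ {n : ℕ}, FreeTerm M n → FreeTerm M n → Prop
  | refl {n : ℕ} (t : FreeTerm M n) : FreeRel t t
  | symm {n : ℕ} {s t : FreeTerm M n} : FreeRel s t → FreeRel t s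
  | trans {n : ℕ} {s t p : FreeTerm M n} : FreeRel s t → FreeRel t p → FreeRel s p
  | gamma_congr {r : ℕ} {n : Fin r → ℕ} {f f' : FreeTerm M r} {g g' : ∀ i, FreeTerm M (n i)} :
      FreeRel f f' → (∀ i, FreeRel (g i) (g' i)) → FreeRel (.gamma n f g) (.gamma n f' g')
  | relabel_congr {n m : ℕ} (e : Fin n ≃ Fin m) {s t : FreeTerm M n} :
      FreeRel s t → FreeRel (.relabel e s) (.relabel e t)
  | add_congr {n : ℕ} {s s' t t' : FreeTerm M n} :
      FreeRel s s' → FreeRel t t' → FreeRel (.add s t) (.add s' t')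
  | smul_congr {n : ℕ} (c : k) {s t : FreeTerm M n} :
      FreeRel s t → FreeRel (.smul c s) (.smul c t)
  | add_assoc {n : ℕ} (s t p : FreeTerm M n) :
      FreeRel (.add (.add s t) p) (.add s (.add t p))
  | add_comm {n : ℕ} (s t : FreeTerm M n) : FreeRel (.add s t) (.add t s)
  | zero_add {n : ℕ} (t : FreeTerm M n) : FreeRel (.add .zero t) t
  | neg_add {n : ℕ} (t : FreeTerm M n) : FreeRel (.add (.smul (-1) t) t) .zero
  | one_smul {n : ℕ} (t : FreeTerm M n) : FreeRel (.smul 1 t) t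
  | mul_smul {n : ℕ} (c d : k) (t : FreeTerm M n) :
      FreeRel (.smul (c * d) t) (.smul c (.smul d t))
  | smul_add {n : ℕ} (c : k) (s t : FreeTerm M n) :
      FreeRel (.smul c (.add s t)) (.add (.smul c s) (.smul c t))
  | add_smul {n : ℕ} (c d : k) (t : FreeTerm M n) :
      FreeRel (.smul (c + d) t) (.add (.smul c t) (.smul d t))
  | relabel_refl {n : ℕ} (t : FreeTerm M n) : FreeRel (.relabel (Equiv.refl (Fin n)) t) t
  | relabel_trans {n m l : ℕ} (e : Fin n ≃ Fin m) (f : Fin m ≃ Fin l) (t : FreeTerm M n) :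
      FreeRel (.relabel (e.trans f) t) (.relabel f (.relabel e t))
  | relabel_add {n m : ℕ} (e : Fin n ≃ Fin m) (s t : FreeTerm M n) :
      FreeRel (.relabel e (.add s t)) (.add (.relabel e s) (.relabel e t))
  | relabel_smul {n m : ℕ} (e : Fin n ≃ Fin m) (c : k) (t : FreeTerm M n) :
      FreeRel (.relabel e (.smul c t)) (.smul c (.relabel e t))
  | gamma_add_outer {r : ℕ} (n : Fin r → ℕ) (f f' : FreeTerm M r) (g : ∀ i, FreeTerm M (n i)) :
      FreeRel (.gamma n (.add f f') g) (.add (.gamma n f g) (.gamma n f' g))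
  | gamma_smul_outer {r : ℕ} (n : Fin r → ℕ) (c : k) (f : FreeTerm M r)
      (g : ∀ i, FreeTerm M (n i)) :
      FreeRel (.gamma n (.smul c f) g) (.smul c (.gamma n f g))
  | gamma_add_inner {r : ℕ} (n : Fin r → ℕ) (f : FreeTerm M r) (g : ∀ i, FreeTerm M (n i))
      (i : Fin r) (s t : FreeTerm M (n i)) :
      FreeRel (.gamma n f (Function.update g i (.add s t)))
        (.add (.gamma n f (Function.update g i s)) (.gamma n f (Function.update g i t)))
  | gamma_smul_inner {r : ℕ} (n : Fin r → ℕ) (f : FreeTerm M r) (g : ∀ i, FreeTerm M (n i))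
      (i : Fin r) (c : k) (t : FreeTerm M (n i)) :
      FreeRel (.gamma n f (Function.update g i (.smul c t)))
        (.smul c (.gamma n f (Function.update g i t)))
  | gamma_relabel_inner {r : ℕ} (n : Fin r → ℕ) (f : FreeTerm M r) (g : ∀ i, FreeTerm M (n i))
      (τ : ∀ i, Equiv.Perm (Fin (n i))) :
      FreeRel (.gamma n f (fun i => .relabel (τ i)⁻¹ (g i)))
        (.relabel (sumPerm τ)⁻¹ (.gamma n f g))
  | gamma_relabel_outer {r : ℕ} (n : Fin r → ℕ) (f : FreeTerm M r) (g : ∀ i, FreeTerm M (n i))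
      (σ : Equiv.Perm (Fin r)) :
      FreeRel (.gamma n (.relabel σ⁻¹ f) g)
        (.relabel (blockEquiv σ n) (.gamma (fun i => n (σ⁻¹ i)) f (fun i => g (σ⁻¹ i))))
  | gamma_assoc {r : ℕ} (n : Fin r → ℕ) (m : ∀ i, Fin (n i) → ℕ) (f : FreeTerm M r)
      (g : ∀ i, FreeTerm M (n i)) (h : ∀ i j, FreeTerm M (m i j)) :
      FreeRel
        (.relabel (assocEquiv n m)
          (.gamma (fun l : Fin (∑ i, n i) =>
              m (finSigmaFinEquiv.symm l).1 (finSigmaFinEquiv.symm l).2)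
            (.gamma n f g)
            (fun l => h (finSigmaFinEquiv.symm l).1 (finSigmaFinEquiv.symm l).2)))
        (.gamma (fun i => ∑ j, m i j) f (fun i => .gamma (m i) (g i) (h i)))
  | gamma_one_left {n : ℕ} (f : FreeTerm M n) :
      FreeRel (.relabel (unitLeftEquiv n) (.gamma (fun _ : Fin 1 => n) .one (fun _ => f))) f
  | gamma_one_right {n : ℕ} (f : FreeTerm M n) :
      FreeRel (.relabel (unitRightEquiv n) (.gamma (fun _ : Fin n => 1) f (fun _ => .one))) f
  | gen_add {n : ℕ} (x y : M n) : FreeRel (.gen (x + y)) (.add (.gen x) (.gen y))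
  | gen_smul {n : ℕ} (c : k) (x : M n) : FreeRel (.gen (c • x)) (.smul c (.gen x))
  | gen_act {n : ℕ} (σ : Equiv.Perm (Fin n)) (x : M n) :
      FreeRel (.gen (M.act n σ x)) (.relabel σ⁻¹ (.gen x))

section Free

variable {k : Type u} [Field k] (M : SModule.{u, v} k)

/-- Formal expressions of arity `n` up to the operad axioms. -/
def freeSetoid (n : ℕ) : Setoid (FreeTerm M n) where
  r s t := FreeRel s t
  iseqv := ⟨FreeRel.refl, FreeRel.symm, FreeRel.trans⟩

/-- The space `T(M)(n)`. -/
def FreeCarrier (n : ℕ) : Type (max u v) := Quotient (freeSetoid M n)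

variable {M}

/-- The class of a formal expression in `T(M)(n)`. -/
def freeCls {n : ℕ} (t : FreeTerm M n) : FreeCarrier M n := Quotient.mk (freeSetoid M n) t

theorem freeCls_eq {n : ℕ} {s t : FreeTerm M n} (h : FreeRel s t) : freeCls s = freeCls t :=
  Quotient.sound (s := freeSetoid M n) h

theorem freeCls_surj {n : ℕ} (q : FreeCarrier M n) : ∃ t, freeCls t = q :=
  Quotient.exists_rep q

instance (n : ℕ) : Zero (FreeCarrier M n) := ⟨freeCls .zero⟩

instance (n : ℕ) : Add (FreeCarrier M n) :=
  ⟨Quotient.map₂ (sa := freeSetoid M n) (sb := freeSetoid M n) (sc := freeSetoid M n)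
    FreeTerm.add fun _ _ h _ _ h' => FreeRel.add_congr h h'⟩

instance (n : ℕ) : SMul k (FreeCarrier M n) :=
  ⟨fun c => Quotient.map (sa := freeSetoid M n) (sb := freeSetoid M n)
    (FreeTerm.smul c) fun _ _ h => FreeRel.smul_congr c h⟩

instance (n : ℕ) : Neg (FreeCarrier M n) := ⟨fun q => (-1 : k) • q⟩

instance (n : ℕ) : AddCommGroup (FreeCarrier M n) :=
  { AddGroup.ofLeftAxioms
      (by
        intro a b c
        obtain ⟨s, rfl⟩ := freeCls_surj a
        obtain ⟨t, rfl⟩ := freeCls_surj b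
        obtain ⟨p, rfl⟩ := freeCls_surj c
        exact freeCls_eq (FreeRel.add_assoc s t p))
      (by
        intro a
        obtain ⟨s, rfl⟩ := freeCls_surj a
        exact freeCls_eq (FreeRel.zero_add s))
      (by
        intro a
        obtain ⟨s, rfl⟩ := freeCls_surj a
        exact freeCls_eq (FreeRel.neg_add s)) with
    add_comm := by
      intro a b
      obtain ⟨s, rfl⟩ := freeCls_surj a
      obtain ⟨t, rfl⟩ := freeCls_surj b
      exact freeCls_eq (FreeRel.add_comm s t) }

instance (n : ℕ) : Module k (FreeCarrier M n) :=
  Module.ofMinimalAxioms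
    (by
      intro c a b
      obtain ⟨s, rfl⟩ := freeCls_surj a
      obtain ⟨t, rfl⟩ := freeCls_surj b
      exact freeCls_eq (FreeRel.smul_add c s t))
    (by
      intro c d a
      obtain ⟨s, rfl⟩ := freeCls_surj a
      exact freeCls_eq (FreeRel.add_smul c d s))
    (by
      intro c d a
      obtain ⟨s, rfl⟩ := freeCls_surj a
      exact freeCls_eq (FreeRel.mul_smul c d s))
    (by
      intro a
      obtain ⟨s, rfl⟩ := freeCls_surj a
      exact freeCls_eq (FreeRel.one_smul s))

variable (M)

/-- The underlying `𝕊`-module of the free operad. -/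
def freeSModule : SModule.{u, max u v} k where
  carrier := FreeCarrier M
  act n σ :=
    { toFun := Quotient.map (sa := freeSetoid M n) (sb := freeSetoid M n)
        (FreeTerm.relabel σ⁻¹) fun _ _ h => FreeRel.relabel_congr _ h
      map_add' := by
        intro a b
        obtain ⟨s, rfl⟩ := freeCls_surj a
        obtain ⟨t, rfl⟩ := freeCls_surj b
        exact freeCls_eq (FreeRel.relabel_add _ s t)
      map_smul' := by
        intro c a
        obtain ⟨s, rfl⟩ := freeCls_surj a
        exact freeCls_eq (FreeRel.relabel_smul _ c s) }
  act_one n a := by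
    obtain ⟨s, rfl⟩ := freeCls_surj a
    exact freeCls_eq (FreeRel.relabel_refl s)
  act_mul n σ τ a := by
    obtain ⟨s, rfl⟩ := freeCls_surj a
    exact freeCls_eq (FreeRel.relabel_trans (σ⁻¹ : Equiv.Perm _) (τ⁻¹ : Equiv.Perm _) s)

variable {M}

/-- The class of a formal expression, as an element of the `𝕊`-module `T(M)`. -/
def freeMk {n : ℕ} (t : FreeTerm M n) : freeSModule M n := freeCls t

theorem freeMk_eq {n : ℕ} {s t : FreeTerm M n} (h : FreeRel s t) : freeMk s = freeMk t :=
  freeCls_eq h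

theorem freeMk_exact {n : ℕ} {s t : FreeTerm M n} (h : freeMk s = freeMk t) : FreeRel s t :=
  Quotient.exact (s := freeSetoid M n) h

theorem freeMk_surj {n : ℕ} (q : freeSModule M n) : ∃ t, freeMk t = q :=
  freeCls_surj q

theorem freeMk_add {n : ℕ} (s t : FreeTerm M n) : freeMk (.add s t) = freeMk s + freeMk t := rfl

theorem freeMk_smul {n : ℕ} (c : k) (t : FreeTerm M n) : freeMk (.smul c t) = c • freeMk t := rfl

theorem freeMk_act {n : ℕ} (σ : Equiv.Perm (Fin n)) (t : FreeTerm M n) :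
    (freeSModule M).act n σ (freeMk t) = freeMk (.relabel σ⁻¹ t) := rfl

theorem freeMk_relabel {n m : ℕ} (e : Fin n ≃ Fin m) (t : FreeTerm M n) :
    (freeSModule M).relabel e (freeMk t) = freeMk (.relabel e t) := by
  obtain rfl : n = m := Fin.equiv_iff_eq.mp ⟨e⟩
  rfl

/-- Composition in the free operad, computed on representatives. -/
noncomputable def freeGammaFun {r : ℕ} (n : Fin r → ℕ) (f : freeSModule M r)
    (g : ∀ i, freeSModule M (n i)) : freeSModule M (∑ i, n i) :=
  freeMk (.gamma n (freeMk_surj f).choose (fun i => (freeMk_surj (g i)).choose))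

theorem freeGammaFun_mk {r : ℕ} (n : Fin r → ℕ) (f : FreeTerm M r) (g : ∀ i, FreeTerm M (n i)) :
    freeGammaFun n (freeMk f) (fun i => freeMk (g i)) = freeMk (.gamma n f g) :=
  freeMk_eq (FreeRel.gamma_congr (freeMk_exact (freeMk_surj (freeMk f)).choose_spec)
    (fun i => freeMk_exact (freeMk_surj (freeMk (g i))).choose_spec))

theorem freeMk_surj_pi {r : ℕ} {n : Fin r → ℕ} (g : ∀ i, freeSModule M (n i)) :
    ∃ t : ∀ i, FreeTerm M (n i), (fun i => freeMk (t i)) = g :=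
  ⟨fun i => (freeMk_surj (g i)).choose, funext fun i => (freeMk_surj (g i)).choose_spec⟩

theorem freeMk_update {r : ℕ} {n : Fin r → ℕ} (g : ∀ i, FreeTerm M (n i)) (i : Fin r)
    (t : FreeTerm M (n i)) :
    Function.update (fun i => freeMk (g i)) i (freeMk t) =
      fun j => freeMk (Function.update g i t j) := by
  funext j
  by_cases h : j = i
  · subst h; simp
  · simp [h]

/-- Composition in the free operad. -/
noncomputable def freeGamma {r : ℕ} (n : Fin r → ℕ) :
    freeSModule M r →ₗ[k]
      MultilinearMap k (fun i => freeSModule M (n i)) (freeSModule M (∑ i, n i)) where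
  toFun f :=
    { toFun := freeGammaFun n f
      map_update_add' := by
        intro inst g i x y
        obtain rfl := Subsingleton.elim inst (instDecidableEqFin r)
        obtain ⟨f, rfl⟩ := freeMk_surj f
        obtain ⟨g, rfl⟩ := freeMk_surj_pi g
        obtain ⟨s, rfl⟩ := freeMk_surj x
        obtain ⟨t, rfl⟩ := freeMk_surj y
        rw [← freeMk_add, freeMk_update, freeMk_update, freeMk_update, freeGammaFun_mk,
          freeGammaFun_mk, freeGammaFun_mk, ← freeMk_add]
        exact freeMk_eq (FreeRel.gamma_add_inner n f g i s t)
      map_update_smul' := by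
        intro inst g i c x
        obtain rfl := Subsingleton.elim inst (instDecidableEqFin r)
        obtain ⟨f, rfl⟩ := freeMk_surj f
        obtain ⟨g, rfl⟩ := freeMk_surj_pi g
        obtain ⟨s, rfl⟩ := freeMk_surj x
        rw [← freeMk_smul, freeMk_update, freeMk_update, freeGammaFun_mk, freeGammaFun_mk,
          ← freeMk_smul]
        exact freeMk_eq (FreeRel.gamma_smul_inner n f g i c s) }
  map_add' f f' := by
    refine MultilinearMap.ext fun g => ?_
    obtain ⟨f, rfl⟩ := freeMk_surj f
    obtain ⟨f', rfl⟩ := freeMk_surj f'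
    obtain ⟨g, rfl⟩ := freeMk_surj_pi g
    change freeGammaFun n (freeMk f + freeMk f') _ =
      freeGammaFun n (freeMk f) _ + freeGammaFun n (freeMk f') _
    rw [← freeMk_add, freeGammaFun_mk, freeGammaFun_mk, freeGammaFun_mk, ← freeMk_add]
    exact freeMk_eq (FreeRel.gamma_add_outer n f f' g)
  map_smul' c f := by
    refine MultilinearMap.ext fun g => ?_
    obtain ⟨f, rfl⟩ := freeMk_surj f
    obtain ⟨g, rfl⟩ := freeMk_surj_pi g
    change freeGammaFun n (c • freeMk f) _ = c • freeGammaFun n (freeMk f) _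
    rw [← freeMk_smul, freeGammaFun_mk, freeGammaFun_mk, ← freeMk_smul]
    exact freeMk_eq (FreeRel.gamma_smul_outer n c f g)

theorem freeGamma_mk {r : ℕ} (n : Fin r → ℕ) (f : FreeTerm M r) (g : ∀ i, FreeTerm M (n i)) :
    freeGamma n (freeMk f) (fun i => freeMk (g i)) = freeMk (.gamma n f g) :=
  freeGammaFun_mk n f g

variable (M)

/-- The free symmetric operad `T(M)` on the `𝕊`-module `M`. -/
noncomputable def freeOperad : SymOperad.{u, max u v} k where
  toSModule := freeSModule M
  one := freeMk .one
  gamma n := freeGamma n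
  gamma_act_inner n f g τ := by
    obtain ⟨f, rfl⟩ := freeMk_surj f
    obtain ⟨g, rfl⟩ := freeMk_surj_pi g
    simp only [freeMk_act]
    rw [freeGamma_mk, freeGamma_mk, freeMk_act]
    exact freeMk_eq (FreeRel.gamma_relabel_inner n f g τ)
  gamma_act_outer n f g σ := by
    obtain ⟨f, rfl⟩ := freeMk_surj f
    obtain ⟨g, rfl⟩ := freeMk_surj_pi g
    rw [freeMk_act, freeGamma_mk, freeGamma_mk _ f (fun i => g (σ⁻¹ i)), freeMk_relabel]
    exact freeMk_eq (FreeRel.gamma_relabel_outer n f g σ)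
  gamma_assoc n m f g h := by
    obtain ⟨f, rfl⟩ := freeMk_surj f
    obtain ⟨g, rfl⟩ := freeMk_surj_pi g
    obtain ⟨h, rfl⟩ : ∃ t : ∀ i j, FreeTerm M (m i j), (fun i j => freeMk (t i j)) = h :=
      ⟨fun i j => (freeMk_surj (h i j)).choose,
        funext fun i => funext fun j => (freeMk_surj (h i j)).choose_spec⟩
    rw [freeGamma_mk, freeGamma_mk _ (.gamma n f g) (fun l =>
      h (finSigmaFinEquiv.symm l).1 (finSigmaFinEquiv.symm l).2), freeMk_relabel]
    simp only [freeGamma_mk]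
    exact freeMk_eq (FreeRel.gamma_assoc n m f g h)
  gamma_one_left f := by
    obtain ⟨f, rfl⟩ := freeMk_surj f
    rw [freeGamma_mk _ _ (fun _ => f), freeMk_relabel]
    exact freeMk_eq (FreeRel.gamma_one_left f)
  gamma_one_right f := by
    obtain ⟨f, rfl⟩ := freeMk_surj f
    rw [freeGamma_mk _ _ (fun _ => .one), freeMk_relabel]
    exact freeMk_eq (FreeRel.gamma_one_right f)

/-- The embedding of the generators `M → T(M)`. -/
def freeGen : SModuleHom M (freeOperad M).toSModule where
  toFun _ :=
    { toFun := fun x => freeMk (.gen x)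
      map_add' := fun x y => freeMk_eq (FreeRel.gen_add x y)
      map_smul' := fun c x => freeMk_eq (FreeRel.gen_smul c x) }
  map_act _ σ x := freeMk_eq (FreeRel.gen_act σ x)

variable {M}

/-- Evaluation of formal expressions in an operad `Q`, given a morphism of `𝕊`-modules `M → Q`. -/
def freeEval {Q : SymOperad.{u, w} k} (φ : SModuleHom M Q.toSModule) :
    ∀ {n : ℕ}, FreeTerm M n → Q n
  | _, .gen x => φ.toFun _ x
  | _, .one => Q.one
  | _, .gamma n f g => Q.gamma n (freeEval φ f) (fun i => freeEval φ (g i))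
  | _, .relabel e t => Q.toSModule.relabel e (freeEval φ t)
  | _, .zero => 0
  | _, .add s t => freeEval φ s + freeEval φ t
  | _, .smul c t => c • freeEval φ t

theorem freeEval_update {Q : SymOperad.{u, w} k} (φ : SModuleHom M Q.toSModule) {r : ℕ}
    {n : Fin r → ℕ} (g : ∀ i, FreeTerm M (n i)) (i : Fin r) (t : FreeTerm M (n i)) :
    (fun j => freeEval φ (Function.update g i t j)) =
      Function.update (fun j => freeEval φ (g j)) i (freeEval φ t) := by
  funext j
  by_cases h : j = i
  · subst h; simp
  · simp [h]

theorem freeEval_rel {Q : SymOperad.{u, w} k} (φ : SModuleHom M Q.toSModule) {n : ℕ}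
    {s t : FreeTerm M n} (h : FreeRel s t) : freeEval φ s = freeEval φ t := by
  induction h with
  | refl => rfl
  | symm _ ih => exact ih.symm
  | trans _ _ ih ih' => exact ih.trans ih'
  | gamma_congr _ _ ih ih' => simp only [freeEval, ih, ih']
  | relabel_congr e _ ih => simp only [freeEval, ih]
  | add_congr _ _ ih ih' => simp only [freeEval, ih, ih']
  | smul_congr c _ ih => simp only [freeEval, ih]
  | add_assoc => exact _root_.add_assoc _ _ _
  | add_comm => exact _root_.add_comm _ _
  | zero_add => exact _root_.zero_add _
  | neg_add => simp [freeEval]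
  | one_smul => exact _root_.one_smul _ _
  | mul_smul => exact SemigroupAction.mul_smul _ _ _
  | smul_add => exact _root_.smul_add _ _ _
  | add_smul => exact _root_.add_smul _ _ _
  | relabel_refl => exact SModule.relabel_refl _ _
  | relabel_trans => exact SModule.relabel_trans _ _ _ _
  | relabel_add => simp [freeEval]
  | relabel_smul => simp [freeEval]
  | gamma_add_outer => simp [freeEval]
  | gamma_smul_outer => simp [freeEval]
  | gamma_add_inner => simp [freeEval, freeEval_update]
  | gamma_smul_inner => simp [freeEval, freeEval_update]
  | gamma_relabel_inner n f g τ =>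
    simp only [freeEval, SModule.relabel_perm, inv_inv]
    exact Q.gamma_act_inner _ _ _ _
  | gamma_relabel_outer n f g σ =>
    simp only [freeEval, SModule.relabel_perm, inv_inv]
    exact Q.gamma_act_outer _ _ _ _
  | gamma_assoc n m f g h =>
    exact Q.gamma_assoc n m (freeEval φ f) (fun i => freeEval φ (g i))
      (fun i j => freeEval φ (h i j))
  | gamma_one_left => exact Q.gamma_one_left _
  | gamma_one_right => exact Q.gamma_one_right _
  | gen_add => simp [freeEval]
  | gen_smul => simp [freeEval]
  | gen_act σ x =>
    simp only [freeEval, SModule.relabel_perm, inv_inv]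
    exact φ.map_act _ σ x

/-- The universal property of the free operad: a morphism of `𝕊`-modules `φ : M → Q` into an operad
extends to a morphism of operads `T(M) → Q`. -/
def freeLift {Q : SymOperad.{u, w} k} (φ : SModuleHom M Q.toSModule) :
    OperadHom (freeOperad M) Q where
  toFun n :=
    { toFun := Quotient.lift (s := freeSetoid M n) (freeEval φ) fun _ _ h => freeEval_rel φ h
      map_add' := by
        intro a b
        obtain ⟨s, rfl⟩ := freeMk_surj a
        obtain ⟨t, rfl⟩ := freeMk_surj b
        rfl
      map_smul' := by
        intro c a
        obtain ⟨s, rfl⟩ := freeMk_surj a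
        rfl }
  map_act n σ a := by
    obtain ⟨s, rfl⟩ := freeMk_surj a
    exact Q.toSModule.relabel_perm σ⁻¹ (freeEval φ s)
  map_one := rfl
  map_gamma n f g := by
    obtain ⟨f, rfl⟩ := freeMk_surj f
    obtain ⟨g, rfl⟩ := freeMk_surj_pi g
    exact congrArg (Quotient.lift (s := freeSetoid M _) (freeEval φ)
      fun _ _ h => freeEval_rel φ h) (freeGamma_mk n f g)

theorem freeLift_gen {Q : SymOperad.{u, w} k} (φ : SModuleHom M Q.toSModule) {n : ℕ} (x : M n) :
    (freeLift φ).toFun n ((freeGen M).toFun n x) = φ.toFun n x := rfl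

/-- The extension `T(M) → Q` of a morphism `M → Q` is unique. -/
theorem free_hom_ext {Q : SymOperad.{u, w} k} {ρ ρ' : OperadHom (freeOperad M) Q}
    (h : ∀ n (x : M n), ρ.toFun n ((freeGen M).toFun n x) = ρ'.toFun n ((freeGen M).toFun n x)) :
    ρ = ρ' := by
  have key : ∀ {n : ℕ} (t : FreeTerm M n), ρ.toFun n (freeMk t) = ρ'.toFun n (freeMk t) := by
    intro n t
    induction t with
    | gen x => exact h _ x
    | one => exact ρ.map_one.trans ρ'.map_one.symm
    | gamma n f g ihf ihg =>
      rw [← freeGamma_mk]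
      refine (ρ.map_gamma n (freeMk f) (fun i => freeMk (g i))).trans
        (Eq.trans ?_ (ρ'.map_gamma n (freeMk f) (fun i => freeMk (g i))).symm)
      rw [ihf]
      simp only [ihg]
    | relabel e t ih =>
      rw [← freeMk_relabel]
      refine (ρ.map_relabel e (freeMk t)).trans (Eq.trans ?_ (ρ'.map_relabel e (freeMk t)).symm)
      rw [ih]
    | zero => exact (map_zero (ρ.toFun _)).trans (map_zero (ρ'.toFun _)).symm
    | add s t ihs iht =>
      refine (map_add (ρ.toFun _) (freeMk s) (freeMk t)).trans
        (Eq.trans ?_ (map_add (ρ'.toFun _) (freeMk s) (freeMk t)).symm)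
      exact congrArg₂ (· + ·) ihs iht
    | smul c t ih =>
      refine (map_smul (ρ.toFun _) c (freeMk t)).trans
        (Eq.trans ?_ (map_smul (ρ'.toFun _) c (freeMk t)).symm)
      exact congrArg (c • ·) ih
  refine OperadHom.ext (funext fun n => LinearMap.ext fun a => ?_)
  obtain ⟨t, rfl⟩ := freeMk_surj a
  exact key t

end Free

/-! ## Operadic ideals and quotient operads -/

/-- An operadic ideal of `P`: subspaces stable under the symmetric groups and such that a composite
lies in the ideal as soon as one of its factors does. -/
structure OperadIdeal {k : Type u} [Field k] (P : SymOperad.{u, v} k) where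
  carrier : ∀ n, Submodule k (P n)
  act_mem : ∀ n (σ : Equiv.Perm (Fin n)) (x : P n), x ∈ carrier n → P.act n σ x ∈ carrier n
  gamma_mem_outer : ∀ {r : ℕ} (n : Fin r → ℕ) (f : P r) (g : ∀ i, P (n i)),
    f ∈ carrier r → P.gamma n f g ∈ carrier _
  gamma_mem_inner : ∀ {r : ℕ} (n : Fin r → ℕ) (f : P r) (g : ∀ i, P (n i)) (i : Fin r),
    g i ∈ carrier (n i) → P.gamma n f g ∈ carrier _

section Ideal

variable {k : Type u} [Field k] {P : SymOperad.{u, v} k}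

/-- The operadic ideal `⟨S⟩` generated by `S`: the intersection of all ideals containing `S`. -/
def operadIdealSpan (S : ∀ n, Set (P n)) : OperadIdeal P where
  carrier n := ⨅ (I : OperadIdeal P) (_ : ∀ n, S n ⊆ I.carrier n), I.carrier n
  act_mem n σ x hx := by
    simp only [Submodule.mem_iInf] at hx ⊢
    exact fun I hI => I.act_mem n σ x (hx I hI)
  gamma_mem_outer n f g hf := by
    simp only [Submodule.mem_iInf] at hf ⊢
    exact fun I hI => I.gamma_mem_outer n f g (hf I hI)
  gamma_mem_inner n f g i hg := by
    simp only [Submodule.mem_iInf] at hg ⊢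
    exact fun I hI => I.gamma_mem_inner n f g i (hg I hI)

variable (I : OperadIdeal P)

/-- The `𝕊`-module `P / I`. -/
def quotientSModule : SModule.{u, v} k where
  carrier n := P n ⧸ I.carrier n
  act n σ := (I.carrier n).mapQ (I.carrier n) (P.act n σ) fun x hx => I.act_mem n σ x hx
  act_one n x := by
    obtain ⟨x, rfl⟩ := (I.carrier n).mkQ_surjective x
    exact congrArg (I.carrier n).mkQ (P.act_one n x)
  act_mul n σ τ x := by
    obtain ⟨x, rfl⟩ := (I.carrier n).mkQ_surjective x
    exact congrArg (I.carrier n).mkQ (P.act_mul n σ τ x)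

/-- The projection `P → P / I` on the level of `𝕊`-modules. -/
def quotientProj : SModuleHom P.toSModule (quotientSModule I) where
  toFun n := (I.carrier n).mkQ
  map_act _ _ _ := rfl

variable {I}

/-- The class of an element of `P` in `P / I`. -/
def quotientMk {n : ℕ} (x : P n) : quotientSModule I n := (quotientProj I).toFun n x

theorem quotientMk_surj {n : ℕ} (q : quotientSModule I n) : ∃ x : P n, quotientMk x = q :=
  (I.carrier n).mkQ_surjective q

theorem quotientMk_eq_iff {n : ℕ} {x y : P n} :
    (quotientMk x : quotientSModule I n) = quotientMk y ↔ x - y ∈ I.carrier n :=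
  Submodule.Quotient.eq (I.carrier n)

theorem quotientMk_add {n : ℕ} (x y : P n) :
    (quotientMk (x + y) : quotientSModule I n) = quotientMk x + quotientMk y := rfl

theorem quotientMk_smul {n : ℕ} (c : k) (x : P n) :
    (quotientMk (c • x) : quotientSModule I n) = c • quotientMk x := rfl

theorem quotientMk_act {n : ℕ} (σ : Equiv.Perm (Fin n)) (x : P n) :
    (quotientSModule I).act n σ (quotientMk x) = quotientMk (P.act n σ x) := rfl

theorem quotientMk_relabel {n m : ℕ} (e : Fin n ≃ Fin m) (x : P n) :
    (quotientSModule I).relabel e (quotientMk x) = quotientMk (P.toSModule.relabel e x) :=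
  ((quotientProj I).map_relabel e x).symm

theorem quotientMk_surj_pi {r : ℕ} {n : Fin r → ℕ} (g : ∀ i, quotientSModule I (n i)) :
    ∃ t : ∀ i, P (n i), (fun i => quotientMk (t i)) = g :=
  ⟨fun i => (quotientMk_surj (g i)).choose, funext fun i => (quotientMk_surj (g i)).choose_spec⟩

theorem quotientMk_update {r : ℕ} {n : Fin r → ℕ} [DecidableEq (Fin r)] (g : ∀ i, P (n i))
    (i : Fin r) (t : P (n i)) :
    Function.update (fun i => (quotientMk (g i) : quotientSModule I (n i))) i (quotientMk t) =
      fun j => quotientMk (Function.update g i t j) := by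
  funext j
  by_cases h : j = i
  · subst h; simp
  · simp [h]

theorem quotientMk_gamma_congr {r : ℕ} (n : Fin r → ℕ) {f f' : P r} {g g' : ∀ i, P (n i)}
    (hf : (quotientMk f : quotientSModule I r) = quotientMk f')
    (hg : ∀ i, (quotientMk (g i) : quotientSModule I (n i)) = quotientMk (g' i)) :
    (quotientMk (P.gamma n f g) : quotientSModule I _) = quotientMk (P.gamma n f' g') := by
  classical
  have h1 : (quotientMk (P.gamma n f g) : quotientSModule I _) = quotientMk (P.gamma n f' g) := by
    rw [quotientMk_eq_iff] at hf ⊢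
    have h := I.gamma_mem_outer n (f - f') g hf
    rwa [map_sub, sub_apply] at h
  rw [h1, quotientMk_eq_iff]
  have h2 : g = g' + fun i => g i - g' i := by
    funext i
    simp
  rw [h2, MultilinearMap.map_add_univ, ← Finset.add_sum_erase _ _ (Finset.mem_univ Finset.univ),
    Finset.piecewise_univ, add_sub_cancel_left]
  refine Submodule.sum_mem _ fun s hs => ?_
  obtain ⟨i, hi⟩ : ∃ i, i ∉ s := by
    by_contra hcon
    push Not at hcon
    exact (Finset.mem_erase.mp hs).1 (Finset.eq_univ_iff_forall.mpr hcon)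
  refine I.gamma_mem_inner n f' _ i ?_
  rw [Finset.piecewise_eq_of_notMem _ _ _ hi]
  exact quotientMk_eq_iff.mp (hg i)

/-- Composition in the quotient operad, computed on representatives. -/
noncomputable def quotientGammaFun {r : ℕ} (n : Fin r → ℕ) (f : quotientSModule I r)
    (g : ∀ i, quotientSModule I (n i)) : quotientSModule I (∑ i, n i) :=
  quotientMk (P.gamma n (quotientMk_surj f).choose (fun i => (quotientMk_surj (g i)).choose))

theorem quotientGammaFun_mk {r : ℕ} (n : Fin r → ℕ) (f : P r) (g : ∀ i, P (n i)) :
    quotientGammaFun n (quotientMk f : quotientSModule I r) (fun i => quotientMk (g i)) =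
      quotientMk (P.gamma n f g) :=
  quotientMk_gamma_congr n (quotientMk_surj (quotientMk f)).choose_spec
    (fun i => (quotientMk_surj (quotientMk (g i))).choose_spec)

/-- Composition in the quotient operad. -/
noncomputable def quotientGamma {r : ℕ} (n : Fin r → ℕ) :
    quotientSModule I r →ₗ[k]
      MultilinearMap k (fun i => quotientSModule I (n i)) (quotientSModule I (∑ i, n i)) where
  toFun f :=
    { toFun := quotientGammaFun n f
      map_update_add' := by
        intro inst g i x y
        obtain ⟨f, rfl⟩ := quotientMk_surj f
        obtain ⟨g, rfl⟩ := quotientMk_surj_pi g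
        obtain ⟨s, rfl⟩ := quotientMk_surj x
        obtain ⟨t, rfl⟩ := quotientMk_surj y
        rw [← quotientMk_add, quotientMk_update, quotientMk_update, quotientMk_update,
          quotientGammaFun_mk, quotientGammaFun_mk, quotientGammaFun_mk, ← quotientMk_add,
          MultilinearMap.map_update_add]
      map_update_smul' := by
        intro inst g i c x
        obtain ⟨f, rfl⟩ := quotientMk_surj f
        obtain ⟨g, rfl⟩ := quotientMk_surj_pi g
        obtain ⟨s, rfl⟩ := quotientMk_surj x
        rw [← quotientMk_smul, quotientMk_update, quotientMk_update, quotientGammaFun_mk,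
          quotientGammaFun_mk, ← quotientMk_smul, MultilinearMap.map_update_smul] }
  map_add' f f' := by
    refine MultilinearMap.ext fun g => ?_
    obtain ⟨f, rfl⟩ := quotientMk_surj f
    obtain ⟨f', rfl⟩ := quotientMk_surj f'
    obtain ⟨g, rfl⟩ := quotientMk_surj_pi g
    change quotientGammaFun n (quotientMk f + quotientMk f') _ =
      quotientGammaFun n (quotientMk f) _ + quotientGammaFun n (quotientMk f') _
    rw [← quotientMk_add, quotientGammaFun_mk, quotientGammaFun_mk, quotientGammaFun_mk,
      ← quotientMk_add, map_add, add_apply]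
  map_smul' c f := by
    refine MultilinearMap.ext fun g => ?_
    obtain ⟨f, rfl⟩ := quotientMk_surj f
    obtain ⟨g, rfl⟩ := quotientMk_surj_pi g
    change quotientGammaFun n (c • quotientMk f) _ = c • quotientGammaFun n (quotientMk f) _
    rw [← quotientMk_smul, quotientGammaFun_mk, quotientGammaFun_mk, ← quotientMk_smul,
      map_smul, smul_apply]

theorem quotientGamma_mk {r : ℕ} (n : Fin r → ℕ) (f : P r) (g : ∀ i, P (n i)) :
    quotientGamma n (quotientMk f : quotientSModule I r) (fun i => quotientMk (g i)) =
      quotientMk (P.gamma n f g) :=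
  quotientGammaFun_mk n f g

variable (I)

/-- The quotient operad `P / I`. -/
noncomputable def quotientOperad : SymOperad.{u, v} k where
  toSModule := quotientSModule I
  one := quotientMk P.one
  gamma n := quotientGamma n
  gamma_act_inner n f g τ := by
    obtain ⟨f, rfl⟩ := quotientMk_surj f
    obtain ⟨g, rfl⟩ := quotientMk_surj_pi g
    simp only [quotientMk_act]
    rw [quotientGamma_mk, quotientGamma_mk, quotientMk_act, P.gamma_act_inner]
  gamma_act_outer n f g σ := by
    obtain ⟨f, rfl⟩ := quotientMk_surj f
    obtain ⟨g, rfl⟩ := quotientMk_surj_pi g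
    rw [quotientMk_act, quotientGamma_mk, quotientGamma_mk _ f (fun i => g (σ⁻¹ i)),
      quotientMk_relabel, P.gamma_act_outer]
  gamma_assoc n m f g h := by
    obtain ⟨f, rfl⟩ := quotientMk_surj f
    obtain ⟨g, rfl⟩ := quotientMk_surj_pi g
    obtain ⟨h, rfl⟩ : ∃ t : ∀ i j, P (m i j), (fun i j => quotientMk (t i j)) = h :=
      ⟨fun i j => (quotientMk_surj (h i j)).choose,
        funext fun i => funext fun j => (quotientMk_surj (h i j)).choose_spec⟩
    rw [quotientGamma_mk, quotientGamma_mk _ (P.gamma n f g) (fun l =>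
      h (finSigmaFinEquiv.symm l).1 (finSigmaFinEquiv.symm l).2), quotientMk_relabel,
      P.gamma_assoc]
    simp only [quotientGamma_mk]
  gamma_one_left f := by
    obtain ⟨f, rfl⟩ := quotientMk_surj f
    rw [quotientGamma_mk _ _ (fun _ => f), quotientMk_relabel, P.gamma_one_left]
  gamma_one_right f := by
    obtain ⟨f, rfl⟩ := quotientMk_surj f
    rw [quotientGamma_mk _ _ (fun _ => P.one), quotientMk_relabel, P.gamma_one_right]

/-- The projection `P → P / I`. -/
noncomputable def quotientHom : OperadHom P (quotientOperad I) where
  toSModuleHom := quotientProj I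
  map_one := rfl
  map_gamma n f g := (quotientGamma_mk n f g).symm

end Ideal

/-! ## Formal power series with coefficients in an operad -/

open Classical in
/-- All families `(c₀; c₁, …, c_r)` of finitely supported exponents on `Ω` with
`c₀ + c₁ + ⋯ + c_r = c`; the index of `c₀` is `none`. -/
noncomputable def exponentSplittings {Ω : Type w} (r : ℕ) (c : Ω →₀ ℕ) :
    Finset (Option (Fin r) → (Ω →₀ ℕ)) :=
  (Finset.univ : Finset (Option (Fin r))).piAntidiag c

theorem mem_exponentSplittings {Ω : Type w} {r : ℕ} {c : Ω →₀ ℕ}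
    {t : Option (Fin r) → (Ω →₀ ℕ)} :
    t ∈ exponentSplittings r c ↔ t none + ∑ i, t (some i) = c := by
  classical
  simp [exponentSplittings, Fintype.sum_option]

section Series

variable {k : Type u} [Field k] (P : SymOperad.{u, v} k) (Ω : Type w)

/-- Formal power series in variables `λ_ω`, `ω ∈ Ω`, with coefficients in `P`: the series
`∑_c F_c λ^c` is the function `c ↦ F_c`. -/
def seriesSModule : SModule.{u, max v w} k where
  carrier n := (Ω →₀ ℕ) → P n
  act n σ := (P.act n σ).compLeft (Ω →₀ ℕ)
  act_one n F := funext fun c => P.act_one n (F c)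
  act_mul n σ τ F := funext fun c => P.act_mul n σ τ (F c)

variable {P Ω}

/-- The coefficient of `λ^c` in a formal power series. -/
def seriesCoeff {n : ℕ} (c : Ω →₀ ℕ) : seriesSModule P Ω n →ₗ[k] P n :=
  (LinearMap.proj c : ((Ω →₀ ℕ) → P n) →ₗ[k] P n)

theorem series_ext {n : ℕ} {F G : seriesSModule P Ω n}
    (h : ∀ c, seriesCoeff c F = seriesCoeff c G) : F = G := funext h

theorem seriesCoeff_act {n : ℕ} (c : Ω →₀ ℕ) (σ : Equiv.Perm (Fin n))
    (F : seriesSModule P Ω n) :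
    seriesCoeff c ((seriesSModule P Ω).act n σ F) = P.act n σ (seriesCoeff c F) := rfl

theorem seriesCoeff_relabel {n m : ℕ} (c : Ω →₀ ℕ) (e : Fin n ≃ Fin m)
    (F : seriesSModule P Ω n) :
    seriesCoeff c ((seriesSModule P Ω).relabel e F) =
      P.toSModule.relabel e (seriesCoeff c F) := by
  obtain rfl : n = m := Fin.equiv_iff_eq.mp ⟨e⟩
  rfl

variable (P Ω)

open Classical in
/-- The constant series `id`. -/
noncomputable def seriesOne : seriesSModule P Ω 1 := fun c => if c = 0 then P.one else 0

/-- Composition of formal power series, the variables `λ_ω` being scalars: the coefficient of `λ^c`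
in `γ(F; G₁, …, G_r)` is the sum of `γ(F_{c₀}; (G₁)_{c₁}, …, (G_r)_{c_r})` over
`c₀ + c₁ + ⋯ + c_r = c`. -/
noncomputable def seriesGamma {r : ℕ} (n : Fin r → ℕ) :
    seriesSModule P Ω r →ₗ[k]
      MultilinearMap k (fun i => seriesSModule P Ω (n i)) (seriesSModule P Ω (∑ i, n i)) where
  toFun F := MultilinearMap.pi fun c => ∑ t ∈ exponentSplittings r c,
    (P.gamma n (seriesCoeff (t none) F)).compLinearMap fun i => seriesCoeff (t (some i))
  map_add' F F' := by
    refine MultilinearMap.ext fun G => funext fun c => ?_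
    change (∑ t ∈ exponentSplittings r c, (P.gamma n (seriesCoeff (t none) (F + F'))).compLinearMap
        fun i => seriesCoeff (t (some i))) G =
      (∑ t ∈ exponentSplittings r c, (P.gamma n (seriesCoeff (t none) F)).compLinearMap
        fun i => seriesCoeff (t (some i))) G +
      (∑ t ∈ exponentSplittings r c, (P.gamma n (seriesCoeff (t none) F')).compLinearMap
        fun i => seriesCoeff (t (some i))) G
    simp only [sum_apply, MultilinearMap.compLinearMap_apply, map_add, add_apply,
      Finset.sum_add_distrib]
  map_smul' a F := by
    refine MultilinearMap.ext fun G => funext fun c => ?_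
    change (∑ t ∈ exponentSplittings r c, (P.gamma n (seriesCoeff (t none) (a • F))).compLinearMap
        fun i => seriesCoeff (t (some i))) G =
      a • (∑ t ∈ exponentSplittings r c, (P.gamma n (seriesCoeff (t none) F)).compLinearMap
        fun i => seriesCoeff (t (some i))) G
    simp only [sum_apply, MultilinearMap.compLinearMap_apply, map_smul, smul_apply,
      Finset.smul_sum]

variable {P Ω}

theorem seriesCoeff_one [DecidableEq (Ω →₀ ℕ)] (c : Ω →₀ ℕ) :
    seriesCoeff c (seriesOne P Ω) = if c = 0 then P.one else 0 := by
  by_cases h : c = 0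
  · rw [if_pos h]
    exact if_pos h
  · rw [if_neg h]
    exact if_neg h

theorem seriesCoeff_gamma {r : ℕ} (n : Fin r → ℕ) (c : Ω →₀ ℕ) (F : seriesSModule P Ω r)
    (G : ∀ i, seriesSModule P Ω (n i)) :
    seriesCoeff c (seriesGamma P Ω n F G) = ∑ t ∈ exponentSplittings r c,
      P.gamma n (seriesCoeff (t none) F) (fun i => seriesCoeff (t (some i)) (G i)) := by
  change (∑ t ∈ exponentSplittings r c, (P.gamma n (seriesCoeff (t none) F)).compLinearMap
    fun i => seriesCoeff (t (some i))) G = _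
  rw [sum_apply]
  rfl

variable (P Ω)

/-- The operad `P[[λ_ω | ω ∈ Ω]]` of formal power series with coefficients in `P`. -/
noncomputable def seriesOperad : SymOperad.{u, max v w} k where
  toSModule := seriesSModule P Ω
  one := seriesOne P Ω
  gamma n := seriesGamma P Ω n
  gamma_act_inner n F G τ := by
    refine series_ext fun c => ?_
    rw [seriesCoeff_act, seriesCoeff_gamma, seriesCoeff_gamma, map_sum]
    exact Finset.sum_congr rfl fun t _ => P.gamma_act_inner n _ _ τ
  gamma_act_outer {r} n F G σ := by
    refine series_ext fun c => ?_
    rw [seriesCoeff_relabel, seriesCoeff_gamma, seriesCoeff_gamma, map_sum]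
    refine Finset.sum_nbij' (fun t o => t (o.map (σ⁻¹ : Equiv.Perm (Fin r))))
      (fun t o => t (o.map σ)) ?_ ?_ ?_ ?_ ?_
    · intro t ht
      rw [mem_exponentSplittings] at ht ⊢
      rw [← ht]
      simp only [Option.map_none, Option.map_some]
      rw [Equiv.sum_comp (σ⁻¹ : Equiv.Perm (Fin r)) (fun i => t (some i))]
    · intro t ht
      rw [mem_exponentSplittings] at ht ⊢
      rw [← ht]
      simp only [Option.map_none, Option.map_some]
      rw [Equiv.sum_comp σ (fun i => t (some i))]
    · intro t _
      funext o
      cases o <;> simp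
    · intro t _
      funext o
      cases o <;> simp
    · intro t _
      exact P.gamma_act_outer n _ (fun i => seriesCoeff (t (some i)) (G i)) σ
  gamma_assoc {r} n m F G H := by
    classical
    refine series_ext fun c => ?_
    rw [seriesCoeff_relabel, seriesCoeff_gamma, seriesCoeff_gamma]
    simp only [seriesCoeff_gamma, map_sum, sum_apply, MultilinearMap.map_sum_finset]
    refine (Finset.sum_sigma' (exponentSplittings _ c)
      (fun s => exponentSplittings r (s none)) _).trans (Eq.trans ?_
        (Finset.sum_sigma' (exponentSplittings r c)
          (fun t => Fintype.piFinset fun i => exponentSplittings (n i) (t (some i))) _).symm)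
    refine Finset.sum_bij'
      (fun p _ => ⟨fun o => o.elim (p.2 none) (fun i => p.2 (some i) +
          ∑ j, p.1 (some (finSigmaFinEquiv ⟨i, j⟩))),
        fun i o => o.elim (p.2 (some i)) (fun j => p.1 (some (finSigmaFinEquiv ⟨i, j⟩)))⟩)
      (fun q _ => ⟨fun o => o.elim (q.1 none + ∑ i, q.2 i none)
          (fun l => q.2 (finSigmaFinEquiv.symm l).1 (some (finSigmaFinEquiv.symm l).2)),
        fun o => o.elim (q.1 none) (fun i => q.2 i none)⟩) ?_ ?_ ?_ ?_ ?_
    · rintro ⟨s, y⟩ hp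
      simp only [Finset.mem_sigma, mem_exponentSplittings, Fintype.mem_piFinset, Option.elim] at hp ⊢
      refine ⟨?_, fun i => trivial⟩
      have hs : ∑ l, s (some l) = ∑ i, ∑ j, s (some (finSigmaFinEquiv ⟨i, j⟩)) := by
        rw [← Equiv.sum_comp finSigmaFinEquiv, Fintype.sum_sigma]
      rw [← hp.1, ← hp.2, Finset.sum_add_distrib, hs, add_assoc]
    · rintro ⟨t, x⟩ hp
      simp only [Finset.mem_sigma, mem_exponentSplittings, Fintype.mem_piFinset, Option.elim] at hp ⊢
      refine ⟨?_, trivial⟩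
      rw [Equiv.sum_comp finSigmaFinEquiv.symm (fun p : Σ i, Fin (n i) => x p.1 (some p.2)),
        Fintype.sum_sigma, add_assoc, ← Finset.sum_add_distrib]
      simp only [hp.2, hp.1]
    · rintro ⟨s, y⟩ hp
      simp only [Finset.mem_sigma, mem_exponentSplittings] at hp
      refine Sigma.ext (funext fun o => ?_) (heq_of_eq (funext fun o => ?_))
      · cases o with
        | none => exact hp.2
        | some l => simp
      · cases o <;> rfl
    · rintro ⟨t, x⟩ hp
      simp only [Finset.mem_sigma, mem_exponentSplittings, Fintype.mem_piFinset] at hp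
      have hx : ∀ (i : Fin r) (j : Fin (n i)),
          x (finSigmaFinEquiv.symm (finSigmaFinEquiv ⟨i, j⟩)).1
            (some (finSigmaFinEquiv.symm (finSigmaFinEquiv ⟨i, j⟩)).2) = x i (some j) :=
        fun i j => congrArg (fun p : Σ i, Fin (n i) => x p.1 (some p.2))
          (finSigmaFinEquiv.symm_apply_apply ⟨i, j⟩)
      refine Sigma.ext (funext fun o => ?_) (heq_of_eq (funext fun i => funext fun o => ?_))
      · cases o with
        | none => rfl
        | some i => simpa [hx] using hp.2 i
      · cases o with
        | none => rfl
        | some j => exact hx i j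
    · rintro ⟨s, y⟩ hp
      refine Eq.trans ?_ (P.gamma_assoc n m (seriesCoeff (y none) F)
        (fun i => seriesCoeff (y (some i)) (G i))
        (fun i j => seriesCoeff (s (some (finSigmaFinEquiv ⟨i, j⟩))) (H i j)))
      simp
  gamma_one_left {n} F := by
    classical
    refine series_ext fun c => ?_
    rw [seriesCoeff_relabel, seriesCoeff_gamma, Finset.sum_eq_single
      (fun o : Option (Fin 1) => o.elim 0 (fun _ => c))]
    · simp [seriesCoeff_one, P.gamma_one_left]
    · intro t ht hne
      rw [mem_exponentSplittings] at ht
      rw [seriesCoeff_one, if_neg, map_zero, zero_apply]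
      intro h0
      apply hne
      funext o
      cases o with
      | none => exact h0
      | some i =>
        rw [h0] at ht
        simpa [Subsingleton.elim i 0] using ht
    · intro h
      exact absurd (mem_exponentSplittings.mpr (by simp)) h
  gamma_one_right {n} F := by
    classical
    refine series_ext fun c => ?_
    rw [seriesCoeff_relabel, seriesCoeff_gamma, Finset.sum_eq_single
      (fun o : Option (Fin n) => o.elim c (fun _ => 0))]
    · simp [seriesCoeff_one, P.gamma_one_right]
    · intro t ht hne
      rw [mem_exponentSplittings] at ht
      obtain ⟨i, hi⟩ : ∃ i, t (some i) ≠ 0 := by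
        by_contra hcon
        push Not at hcon
        apply hne
        funext o
        cases o with
        | none => simpa [hcon] using ht
        | some i => exact hcon i
      refine MultilinearMap.map_coord_zero _ i ?_
      rw [seriesCoeff_one, if_neg hi]
    · intro h
      exact absurd (mem_exponentSplittings.mpr (by simp)) h

end Series

/-! ## Weights, quasipolarizations and linear compatibility -/

section Compat

variable {k : Type u} [Field k] {M : SModule.{u, v} k}

/-- `IsTreeMonomial m t`: the element `t` of `T(M)` is a decorated tree with `m` internal vertices,
that is, it is the trivial tree, or it is obtained by grafting decorated trees on a root vertex
decorated by an element of `M`, with any numbering of the leaves. -/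
inductive IsTreeMonomial : ∀ {n : ℕ}, ℕ → freeOperad M n → Prop
  | trivial : IsTreeMonomial 0 (freeOperad M).one
  | graft {r l : ℕ} (n : Fin r → ℕ) (m : Fin r → ℕ) (x : M r) (t : ∀ i, freeOperad M (n i))
      (ht : ∀ i, IsTreeMonomial (m i) (t i)) (e : Fin (∑ i, n i) ≃ Fin l) :
      IsTreeMonomial (1 + ∑ i, m i)
        ((freeOperad M).toSModule.relabel e
          ((freeOperad M).gamma n ((freeGen M).toFun r x) t))

variable (M) in
/-- `T(M)^{(m)}(n)`, the span of the decorated trees with `m` internal vertices. -/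
noncomputable def weightPart (m n : ℕ) : Submodule k (freeOperad M n) :=
  Submodule.span k {t | IsTreeMonomial m t}

/-- A relation is homogeneous if it lies in `T(M)^{(m)}` for some `m ≥ 0`. -/
def IsHomogeneousRel {n : ℕ} (r : freeOperad M n) : Prop := ∃ m, r ∈ weightPart M m n

/-- The operad `T(M)/⟨R⟩` is locally homogeneous: the ideal `⟨R⟩` is generated by the homogeneous
relations in `R`. -/
def IsLocallyHomogeneous (R : ∀ n, Set (freeOperad M n)) : Prop :=
  operadIdealSpan R = operadIdealSpan fun n => {r | r ∈ R n ∧ IsHomogeneousRel r}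

/-- The operad `T(M)/⟨R⟩` presented by generators `M` and relations `R`. -/
noncomputable def presentedOperad (R : ∀ n, Set (freeOperad M n)) : SymOperad.{u, max u v} k :=
  quotientOperad (operadIdealSpan R)

/-- The class in `T(M)/⟨R⟩` of a generator, as a morphism `M → T(M)/⟨R⟩`. -/
noncomputable def presentedGen (R : ∀ n, Set (freeOperad M n)) :
    SModuleHom M (presentedOperad R).toSModule where
  toFun n := ((quotientHom (operadIdealSpan R)).toFun n).comp ((freeGen M).toFun n)
  map_act n σ x := by
    have h := (freeGen M).map_act n σ x
    have h' := (quotientHom (operadIdealSpan R)).map_act n σ ((freeGen M).toFun n x)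
    exact (congrArg ((quotientHom (operadIdealSpan R)).toFun n) h).trans h'

variable (M) in
/-- The direct sum `⨁_{ω ∈ Ω} M_ω` of copies of `M`; `x_ω` is `Finsupp.single ω x`. -/
noncomputable def replicas (Ω : Type w) : SModule.{u, max v w} k where
  carrier n := Ω →₀ M n
  act n σ := Finsupp.mapRange.linearMap (M.act n σ)
  act_one n x := by
    ext ω
    exact M.act_one n (x ω)
  act_mul n σ τ x := by
    ext ω
    exact M.act_mul n σ τ (x ω)

variable (M) in
/-- The inclusion `M → ⨁_{ω ∈ Ω} M_ω`, `x ↦ x_ω`. -/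
noncomputable def replicaIncl {Ω : Type w} (ω : Ω) : SModuleHom M (replicas M Ω) where
  toFun n := Finsupp.lsingle ω
  map_act n σ x := by
    change Finsupp.single ω (M.act n σ x) =
      Finsupp.mapRange.linearMap (M.act n σ) (Finsupp.single ω x)
    simp

variable (M) in
open Classical in
/-- The formal linear combination `x ↦ ∑_{ω ∈ Ω} λ_ω x_ω`: the coefficient of `λ_ω` is `x_ω`, and
the other coefficients vanish. -/
noncomputable def formalCombination (Ω : Type w) :
    SModuleHom M (seriesOperad (freeOperad (replicas M Ω)) Ω).toSModule where
  toFun n := LinearMap.pi fun c : Ω →₀ ℕ => ∑ ω ∈ c.support,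
    if c = Finsupp.single ω 1 then
      ((freeGen (replicas M Ω)).toFun n).comp ((replicaIncl M ω).toFun n) else 0
  map_act n σ x := by
    refine series_ext fun c => ?_
    change (∑ ω ∈ c.support, if c = Finsupp.single ω 1 then
        ((freeGen (replicas M Ω)).toFun n).comp ((replicaIncl M ω).toFun n) else 0) (M.act n σ x) =
      (freeOperad (replicas M Ω)).act n σ ((∑ ω ∈ c.support, if c = Finsupp.single ω 1 then
        ((freeGen (replicas M Ω)).toFun n).comp ((replicaIncl M ω).toFun n) else 0) x)
    rw [LinearMap.sum_apply, LinearMap.sum_apply, map_sum]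
    refine Finset.sum_congr rfl fun ω _ => ?_
    split_ifs
    · rw [LinearMap.comp_apply, (replicaIncl M ω).map_act]
      exact (freeGen (replicas M Ω)).map_act n σ _
    · simp

/-- The substitution `f(X) ↦ f(X)|_{x ↦ ∑ λ_ω x_ω}`, a morphism from `T(M)` to the formal power
series in the `λ_ω` over `T(⨁ M_ω)`. -/
noncomputable def expansion (Ω : Type w) :
    OperadHom (freeOperad M) (seriesOperad (freeOperad (replicas M Ω)) Ω) :=
  freeLift (formalCombination M Ω)

/-- The quasipolarization `f_c(X_Ω)` of `f` of type `c`: the coefficient of `∏ λ_ω^{c_ω}` in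
`f(X)|_{x ↦ ∑ λ_ω x_ω}`. -/
noncomputable def quasipolarization {Ω : Type w} (c : Ω →₀ ℕ) {n : ℕ} (f : freeOperad M n) :
    freeOperad (replicas M Ω) n :=
  seriesCoeff c ((expansion Ω).toFun n f)

/-- The set of all quasipolarizations `r_c` of the homogeneous relations `r` in `R`, where `c` runs
over the maps `Ω → ℤ_{≥ 0}` whose values sum up to the weight of `r`. -/
def linRelations (Ω : Type w) (R : ∀ n, Set (freeOperad M n)) (n : ℕ) :
    Set (freeOperad (replicas M Ω) n) :=
  {q | ∃ (r : freeOperad M n) (m : ℕ) (c : Ω →₀ ℕ),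
    r ∈ R n ∧ r ∈ weightPart M m n ∧ c.degree = m ∧ q = quasipolarization c r}

/-- The linearly compatible operad of `T(M)/⟨R⟩` with parameter set `Ω`. -/
noncomputable def linOperad (Ω : Type w) (R : ∀ n, Set (freeOperad M n)) :
    SymOperad.{u, max u v w} k :=
  presentedOperad (linRelations Ω R)

variable {V : Type x} [AddCommGroup V] [Module k V]

/-- The operations `ν : M → End_V` make `V` an algebra over `T(M)/⟨R⟩`: there is a morphism of
operads `T(M)/⟨R⟩ → End_V` under which the generators act by `ν`. -/
def IsAlgebraStructure (R : ∀ n, Set (freeOperad M n))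
    (ν : SModuleHom M (endOperad k V).toSModule) : Prop :=
  ∃ ρ : OperadHom (presentedOperad R) (endOperad k V),
    ∀ n (x : M n), ρ.toFun n ((presentedGen R).toFun n x) = ν.toFun n x

/-- The linear combination `∑_ω a_ω μ_ω` of families of operations. -/
noncomputable def linearCombination {Ω : Type w} {N : SModule.{u, x} k} (a : Ω →₀ k)
    (μ : Ω → SModuleHom M N) : SModuleHom M N where
  toFun n := ∑ ω ∈ a.support, a ω • (μ ω).toFun n
  map_act n σ x := by
    simp [LinearMap.sum_apply, (μ _).map_act]

/-- `V` with the replicated operations `μ_ω : M → End_V`, `ω ∈ Ω`, is an `Ω`-linearly compatible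
algebra over `T(M)/⟨R⟩`. -/
def IsLinearlyCompatible {Ω : Type w} (R : ∀ n, Set (freeOperad M n))
    (μ : Ω → SModuleHom M (endOperad k V).toSModule) : Prop :=
  (∀ ω, IsAlgebraStructure R (μ ω)) ∧
    ∀ a : Ω →₀ k, IsAlgebraStructure R (linearCombination a μ)

/-- The replicated operations on an algebra over the linearly compatible operad: `μ_ω(x)` is the
action of the generator `x_ω`. -/
noncomputable def replicatedOperations {Ω : Type w} {R : ∀ n, Set (freeOperad M n)}
    (ρ : OperadHom (linOperad Ω R) (endOperad k V)) :
    Ω → SModuleHom M (endOperad k V).toSModule := fun ω =>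
  { toFun := fun n => (ρ.toFun n).comp
      (((presentedGen (linRelations Ω R)).toFun n).comp ((replicaIncl M ω).toFun n))
    map_act := by
      intro n σ x
      have h1 := (replicaIncl M ω).map_act n σ x
      have h2 := (presentedGen (linRelations Ω R)).map_act n σ ((replicaIncl M ω).toFun n x)
      have h3 := ρ.map_act n σ
        ((presentedGen (linRelations Ω R)).toFun n ((replicaIncl M ω).toFun n x))
      change ρ.toFun n ((presentedGen (linRelations Ω R)).toFun n
        ((replicaIncl M ω).toFun n (M.act n σ x))) = _
      rw [h1, h2]
      exact h3 }

end Compat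

/-! By the universal properties of free operads and quotients, both structures are vanishing
conditions. Write Φ for the morphism `T(⨁ M_ω) → End_V` that sends `x_ω` to `μ_ω(x)`. The family `μ`
comes from a `Lin P_Ω`-algebra structure exactly when Φ kills every `r_c`
(`exists_replicatedOperations_eq_iff`). By local homogeneity, `ν` is a `P`-algebra structure exactly
when its extension to `T(M)` kills the homogeneous relations
(`isAlgebraStructure_iff_of_isLocallyHomogeneous`). Injectivity holds because the classes of the
`x_ω` generate `Lin P_Ω`.

The bridge is the expansion formula `freeLift_linearCombination`: for `r` of weight `m` and finitely
supported scalars `a`, one has `r(∑ a_ω μ_ω) = ∑_c a^c Φ(r_c)`, with `c` of degree `m` and supported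
in a finite set containing the support of `a`. It rests on two facts. Evaluating formal series at
`a` respects the operad operations, so that the formal expansion specializes to the substitution `x
↦ ∑ a_ω x_ω` (`evaluatesTo_expansion`); and `r_c = 0` unless `c` has degree `m`
(`quasipolarization_eq_zero`).

If every `Φ(r_c)` vanishes, so does the left side for all `a`. Conversely, fix `c` and restrict to
scalars supported in the support of `c`. The right side is then a polynomial in finitely many
variables with coefficients in `End_V(n)` that vanishes at every point, and over an infinite field
all its coefficients vanish, `Φ(r_c)` among them. Characteristic zero enters only through the
infinitude of `k`. -/

/-! ## Morphisms out of presented operads -/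

section Presented

variable {k : Type u} [Field k]

/-- The composite of two morphisms of operads. -/
def OperadHom.comp {P : SymOperad.{u, v} k} {Q : SymOperad.{u, w} k} {S : SymOperad.{u, x} k}
    (ψ : OperadHom Q S) (φ : OperadHom P Q) : OperadHom P S where
  toFun n := (ψ.toFun n).comp (φ.toFun n)
  map_act n σ x := (congrArg (ψ.toFun n) (φ.map_act n σ x)).trans (ψ.map_act n σ _)
  map_one := (congrArg (ψ.toFun 1) φ.map_one).trans ψ.map_one
  map_gamma n f g := (congrArg (ψ.toFun _) (φ.map_gamma n f g)).trans (ψ.map_gamma n _ _)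

/-- The kernel of a morphism of operads. -/
def OperadHom.ker {P : SymOperad.{u, v} k} {Q : SymOperad.{u, w} k} (φ : OperadHom P Q) :
    OperadIdeal P where
  carrier n := LinearMap.ker (φ.toFun n)
  act_mem n σ x hx := by
    rw [LinearMap.mem_ker] at hx ⊢
    rw [φ.map_act, hx, map_zero]
  gamma_mem_outer n f g hf := by
    rw [LinearMap.mem_ker] at hf ⊢
    rw [φ.map_gamma, hf, map_zero, zero_apply]
  gamma_mem_inner n f g i hg := by
    rw [LinearMap.mem_ker] at hg ⊢
    rw [φ.map_gamma]
    exact MultilinearMap.map_coord_zero _ i hg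

theorem OperadHom.mem_ker {P : SymOperad.{u, v} k} {Q : SymOperad.{u, w} k} (φ : OperadHom P Q)
    {n : ℕ} {x : P n} : x ∈ φ.ker.carrier n ↔ φ.toFun n x = 0 := LinearMap.mem_ker

theorem subset_operadIdealSpan {P : SymOperad.{u, v} k} (S : ∀ n, Set (P n)) (n : ℕ) :
    S n ⊆ (operadIdealSpan S).carrier n := by
  intro x hx
  simp only [operadIdealSpan, SetLike.mem_coe, Submodule.mem_iInf]
  exact fun I hI => hI n hx

theorem operadIdealSpan_le {P : SymOperad.{u, v} k} {S : ∀ n, Set (P n)} {I : OperadIdeal P}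
    (h : ∀ n, S n ⊆ I.carrier n) (n : ℕ) :
    (operadIdealSpan S).carrier n ≤ I.carrier n :=
  iInf₂_le I h

/-- A morphism of operads that vanishes on an ideal descends to the quotient. -/
def OperadHom.quotientLift {P : SymOperad.{u, v} k} {Q : SymOperad.{u, w} k} (I : OperadIdeal P)
    (φ : OperadHom P Q) (h : ∀ n, I.carrier n ≤ φ.ker.carrier n) :
    OperadHom (quotientOperad I) Q where
  toFun n := (I.carrier n).liftQ (φ.toFun n) (h n)
  map_act n σ q := by
    obtain ⟨x, rfl⟩ := quotientMk_surj q
    exact φ.map_act n σ x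
  map_one := φ.map_one
  map_gamma n f g := by
    obtain ⟨f, rfl⟩ := quotientMk_surj f
    obtain ⟨g, rfl⟩ := quotientMk_surj_pi g
    exact (congrArg ((I.carrier _).liftQ (φ.toFun _) (h _)) (quotientGamma_mk n f g)).trans
      (φ.map_gamma n f g)

/-- A morphism out of a quotient operad is determined by its composite with the projection. -/
theorem OperadHom.quotient_hom_ext {P : SymOperad.{u, v} k} {Q : SymOperad.{u, w} k}
    {I : OperadIdeal P} {ρ ρ' : OperadHom (quotientOperad I) Q}
    (h : ρ.comp (quotientHom I) = ρ'.comp (quotientHom I)) : ρ = ρ' := by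
  refine OperadHom.ext (funext fun n => LinearMap.ext fun q => ?_)
  obtain ⟨x, rfl⟩ := quotientMk_surj q
  exact congrArg (fun φ : OperadHom P Q => φ.toFun n x) h

variable {M : SModule.{u, v} k}

/-- Both sides agree on the generators, and these determine a morphism out of a free operad. The
value of `ρ` on the class of a relation thereby becomes a value of `freeLift ν`. -/
theorem comp_quotientHom_eq_freeLift {Q : SymOperad.{u, w} k} {R : ∀ n, Set (freeOperad M n)}
    (ρ : OperadHom (presentedOperad R) Q) (ν : SModuleHom M Q.toSModule)
    (h : ∀ n (x : M n), ρ.toFun n ((presentedGen R).toFun n x) = ν.toFun n x) :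
    OperadHom.comp ρ (quotientHom (operadIdealSpan R)) = freeLift ν :=
  free_hom_ext fun n x => h n x

/-- A morphism on generators extends to the presented operad if and only if its extension to the
free operad kills the relations. -/
theorem exists_presentedOperad_hom_iff {Q : SymOperad.{u, w} k} {R : ∀ n, Set (freeOperad M n)}
    (ν : SModuleHom M Q.toSModule) :
    (∃ ρ : OperadHom (presentedOperad R) Q,
        ∀ n (x : M n), ρ.toFun n ((presentedGen R).toFun n x) = ν.toFun n x) ↔
      ∀ n, ∀ r ∈ R n, (freeLift ν).toFun n r = 0 := by
  constructor
  · rintro ⟨ρ, hρ⟩ n r hr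
    rw [← comp_quotientHom_eq_freeLift ρ ν hρ]
    have h0 : (quotientMk r : quotientSModule (operadIdealSpan R) n) = quotientMk 0 := by
      rw [quotientMk_eq_iff, sub_zero]
      exact subset_operadIdealSpan R n hr
    exact (congrArg (ρ.toFun n) h0).trans (map_zero (ρ.toFun n))
  · intro h
    exact ⟨OperadHom.quotientLift _ (freeLift ν)
      (operadIdealSpan_le fun n r hr => (OperadHom.mem_ker _).mpr (h n r hr)), fun n x => rfl⟩

end Presented

/-! ## Evaluation of formal power series at scalars -/

section Evaluation

variable {k : Type u} [Field k] {P : SymOperad.{u, v} k} {Ω : Type w}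

/-- The value of the monomial `λ^c` at the scalars `a`. -/
def monomialValue (a : Ω → k) (c : Ω →₀ ℕ) : k := c.prod fun ω e => a ω ^ e

theorem monomialValue_zero (a : Ω → k) : monomialValue a 0 = 1 := Finsupp.prod_zero_index

/-- Multiplicativity in the exponent is what makes evaluation at scalars compatible with the
convolution in `seriesGamma`. -/
theorem monomialValue_add (a : Ω → k) (c d : Ω →₀ ℕ) :
    monomialValue a (c + d) = monomialValue a c * monomialValue a d := by
  classical
  exact Finsupp.prod_add_index' (fun _ => pow_zero _) (fun _ _ _ => pow_add _ _ _)

theorem monomialValue_sum (a : Ω → k) {ι : Type*} (s : Finset ι) (c : ι → Ω →₀ ℕ) :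
    monomialValue a (∑ i ∈ s, c i) = ∏ i ∈ s, monomialValue a (c i) := by
  classical
  induction s using Finset.induction_on with
  | empty => simp [monomialValue_zero]
  | insert i s hi ih => rw [Finset.sum_insert hi, Finset.prod_insert hi, monomialValue_add, ih]

theorem monomialValue_single_one (a : Ω → k) (ω : Ω) :
    monomialValue a (Finsupp.single ω 1) = a ω := by
  simp [monomialValue]

theorem monomialValue_eq_zero {a : Ω → k} {c : Ω →₀ ℕ} {ω : Ω} (h : ω ∈ c.support) (ha : a ω = 0) :
    monomialValue a c = 0 :=
  Finset.prod_eq_zero h (by simp only [ha, zero_pow (Finsupp.mem_support_iff.mp h)])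

/-- The series `F`, evaluated at `λ = a`, has only finitely many nonzero terms, with sum `f`. -/
def EvaluatesTo (a : Ω → k) {n : ℕ} (F : seriesSModule P Ω n) (f : P n) : Prop :=
  ∃ s : Finset (Ω →₀ ℕ), (∀ c ∉ s, monomialValue a c • seriesCoeff c F = 0) ∧
    ∑ c ∈ s, monomialValue a c • seriesCoeff c F = f

/-- Passing from either finite set to the union adds only zero terms. The value is therefore unique,
and it may be computed over whichever finite set of exponents is convenient. -/
theorem EvaluatesTo.sum_eq {a : Ω → k} {n : ℕ} {F : seriesSModule P Ω n} {f : P n}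
    (h : EvaluatesTo a F f) {s : Finset (Ω →₀ ℕ)}
    (hs : ∀ c ∉ s, monomialValue a c • seriesCoeff c F = 0) :
    ∑ c ∈ s, monomialValue a c • seriesCoeff c F = f := by
  classical
  obtain ⟨s', hs', rfl⟩ := h
  rw [Finset.sum_subset (Finset.subset_union_left (s₂ := s')) fun c _ hc => hs c hc,
    Finset.sum_subset (Finset.subset_union_right (s₁ := s)) fun c _ hc => hs' c hc]

theorem EvaluatesTo.one (a : Ω → k) : EvaluatesTo a (seriesOne P Ω) P.one := by
  classical
  refine ⟨{0}, fun c hc => ?_, ?_⟩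
  · rw [seriesCoeff_one, if_neg (by simpa using hc), smul_zero]
  · rw [Finset.sum_singleton, seriesCoeff_one, if_pos rfl, monomialValue_zero, one_smul]

theorem EvaluatesTo.zero (a : Ω → k) {n : ℕ} :
    EvaluatesTo a (0 : seriesSModule P Ω n) (0 : P n) :=
  ⟨∅, fun c _ => by rw [map_zero, smul_zero], Finset.sum_empty⟩

theorem EvaluatesTo.add {a : Ω → k} {n : ℕ} {F G : seriesSModule P Ω n} {f g : P n}
    (hF : EvaluatesTo a F f) (hG : EvaluatesTo a G g) : EvaluatesTo a (F + G) (f + g) := by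
  classical
  have hF' := hF
  have hG' := hG
  obtain ⟨s, hs, -⟩ := hF'
  obtain ⟨t, ht, -⟩ := hG'
  refine ⟨s ∪ t, fun c hc => ?_, ?_⟩
  · rw [Finset.mem_union, not_or] at hc
    rw [map_add, smul_add, hs c hc.1, ht c hc.2, add_zero]
  · simp only [map_add, smul_add, Finset.sum_add_distrib]
    rw [hF.sum_eq fun c hc => hs c fun h => hc (Finset.mem_union_left t h),
      hG.sum_eq fun c hc => ht c fun h => hc (Finset.mem_union_right s h)]

/-- A linear map applied coefficientwise commutes with a finite sum. This serves both relabelling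
and multiplication by a scalar. -/
theorem EvaluatesTo.map {a : Ω → k} {n m : ℕ} {F : seriesSModule P Ω n}
    {G : seriesSModule P Ω m} {f : P n} (hF : EvaluatesTo a F f) (ψ : P n →ₗ[k] P m)
    (h : ∀ c, seriesCoeff c G = ψ (seriesCoeff c F)) : EvaluatesTo a G (ψ f) := by
  obtain ⟨s, hs, rfl⟩ := hF
  refine ⟨s, fun c hc => ?_, ?_⟩
  · rw [h, ← map_smul, hs c hc, map_zero]
  · simp only [h, map_sum, map_smul]

/-- Multilinearity expands a composite of finite sums into a sum over tuples `(c₀; c₁, …, c_r)`, and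
the scalars of a tuple multiply to `a^(c₀ + ⋯ + c_r)`. Grouping the tuples by their total exponent
gives the coefficients of `seriesGamma`. -/
theorem EvaluatesTo.gamma {a : Ω → k} {r : ℕ} {n : Fin r → ℕ} {F : seriesSModule P Ω r}
    {G : ∀ i, seriesSModule P Ω (n i)} {f : P r} {g : ∀ i, P (n i)} (hF : EvaluatesTo a F f)
    (hG : ∀ i, EvaluatesTo a (G i) (g i)) :
    EvaluatesTo a (seriesGamma P Ω n F G) (P.gamma n f g) := by
  classical
  obtain ⟨s, hs, rfl⟩ := hF
  choose t ht hg using hG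
  obtain rfl : (fun i => ∑ c ∈ t i, monomialValue a c • seriesCoeff c (G i)) = g := funext hg
  -- `T p` is the contribution of the tuple `p` with its scalars inserted. `B` is the finite box of
  -- tuples allowed by the finite sets of the factors; outside it some argument of `γ` is zero.
  set T : (Option (Fin r) → (Ω →₀ ℕ)) → P (∑ i, n i) := fun p =>
    P.gamma n (monomialValue a (p none) • seriesCoeff (p none) F)
      (fun i => monomialValue a (p (some i)) • seriesCoeff (p (some i)) (G i)) with hT
  set B : Finset (Option (Fin r) → (Ω →₀ ℕ)) :=
    Fintype.piFinset fun o => o.elim s t with hB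
  have hT0 : ∀ p ∉ B, T p = 0 := by
    intro p hp
    simp only [hB, Fintype.mem_piFinset, not_forall] at hp
    obtain ⟨o, ho⟩ := hp
    cases o with
    | none => simp only [hT]; rw [hs _ ho, map_zero, zero_apply]
    | some i => exact MultilinearMap.map_coord_zero _ i (ht i _ ho)
  have hcoeff : ∀ c, monomialValue a c • seriesCoeff c (seriesGamma P Ω n F G) =
      ∑ p ∈ exponentSplittings r c, T p := by
    intro c
    rw [seriesCoeff_gamma, Finset.smul_sum]
    refine Finset.sum_congr rfl fun p hp => ?_
    rw [mem_exponentSplittings] at hp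
    simp only [hT]
    -- The scalars are pulled out of all the arguments of `γ` and combined into the value of the
    -- monomial with the total exponent `c`.
    rw [MultilinearMap.map_smul_univ, map_smul, smul_apply, smul_smul, ← hp, monomialValue_add,
      monomialValue_sum, mul_comm]
  have hsum : ∀ p ∈ B, p none + ∑ i, p (some i) ∈
      B.image fun p => p none + ∑ i, p (some i) := fun p hp =>
    Finset.mem_image_of_mem (fun p : Option (Fin r) → (Ω →₀ ℕ) => p none + ∑ i, p (some i)) hp
  -- The exponents that can contribute are the totals attained on the box.
  refine ⟨B.image fun p => p none + ∑ i, p (some i), fun c hc => ?_, ?_⟩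
  · rw [hcoeff]
    refine Finset.sum_eq_zero fun p hp => hT0 p fun hpB => hc ?_
    rw [← mem_exponentSplittings.mp hp]
    exact hsum p hpB
  · have h1 : ∀ c, ∑ p ∈ exponentSplittings r c, T p =
        ∑ p ∈ B with p none + ∑ i, p (some i) = c, T p := by
      intro c
      refine (Finset.sum_subset (fun p hp => ?_) fun p hp hp' => ?_).symm
      · exact mem_exponentSplittings.mpr (Finset.mem_filter.mp hp).2
      · exact hT0 p fun hpB =>
          hp' (Finset.mem_filter.mpr ⟨hpB, mem_exponentSplittings.mp hp⟩)
    simp only [hcoeff, h1]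
    -- Summing over the fibres of the total exponent gives the sum of `T` over all of `B`. The other
    -- side, expanded by multilinearity, is a sum over pairs of an outer exponent and a family of
    -- inner ones; such pairs are the functions on `Option (Fin r)`.
    rw [Finset.sum_fiberwise_of_maps_to hsum, map_sum, sum_apply]
    simp only [MultilinearMap.map_sum_finset]
    rw [← Finset.sum_product']
    refine Finset.sum_bij' (fun p _ => (p none, fun i => p (some i)))
      (fun q _ o => o.elim q.1 q.2) ?_ ?_ ?_ ?_ ?_
    · intro p hp
      rw [hB, Fintype.mem_piFinset] at hp
      exact Finset.mem_product.mpr ⟨hp none, Fintype.mem_piFinset.mpr fun i => hp (some i)⟩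
    · intro q hq
      rw [Finset.mem_product, Fintype.mem_piFinset] at hq
      rw [hB, Fintype.mem_piFinset]
      rintro (_ | i)
      exacts [hq.1, hq.2 i]
    · intro p _
      funext o
      cases o <;> rfl
    · intro q _
      rfl
    · intro p _
      rfl

end Evaluation

/-! ## Quasipolarizations -/

section Quasipolarization

variable {k : Type u} [Field k] {M : SModule.{u, v} k} {Ω : Type w}

variable (M) in
/-- The replicated generator `x ↦ x_ω` of the free operad. -/
noncomputable def replicaGen (ω : Ω) : SModuleHom M (freeOperad (replicas M Ω)).toSModule where
  toFun n := ((freeGen (replicas M Ω)).toFun n).comp ((replicaIncl M ω).toFun n)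
  map_act n σ x := (congrArg ((freeGen (replicas M Ω)).toFun n)
    ((replicaIncl M ω).map_act n σ x)).trans ((freeGen (replicas M Ω)).map_act n σ _)

theorem seriesCoeff_formalCombination_single {n : ℕ} (ω : Ω) (x : M n) :
    seriesCoeff (Finsupp.single ω 1) ((formalCombination M Ω).toFun n x) =
      (replicaGen M ω).toFun n x := by
  classical
  change (∑ ω' ∈ (Finsupp.single ω 1).support, if Finsupp.single ω 1 = Finsupp.single ω' 1 then
    ((freeGen (replicas M Ω)).toFun n).comp ((replicaIncl M ω').toFun n) else 0) x = _
  rw [Finsupp.support_single _ one_ne_zero, Finset.sum_singleton, if_pos rfl]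
  rfl

theorem seriesCoeff_formalCombination_of_ne {n : ℕ} {c : Ω →₀ ℕ}
    (h : ∀ ω, c ≠ Finsupp.single ω 1) (x : M n) :
    seriesCoeff c ((formalCombination M Ω).toFun n x) = 0 := by
  classical
  change (∑ ω' ∈ c.support, if c = Finsupp.single ω' 1 then
    ((freeGen (replicas M Ω)).toFun n).comp ((replicaIncl M ω').toFun n) else 0) x = 0
  rw [Finset.sum_eq_zero fun ω _ => if_neg (h ω)]
  rfl

/-- Only the exponents `Finsupp.single ω 1` contribute, each with scalar `a ω`. The series itself
may have infinitely many nonzero coefficients; the finite support of `a` is what makes its value a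
finite sum. -/
theorem evaluatesTo_formalCombination (a : Ω →₀ k) {n : ℕ} (x : M n) :
    EvaluatesTo a ((formalCombination M Ω).toFun n x)
      ((linearCombination a (replicaGen M)).toFun n x) := by
  classical
  have hinj : Function.Injective fun ω : Ω => Finsupp.single ω 1 :=
    Finsupp.single_left_injective (one_ne_zero : (1 : ℕ) ≠ 0)
  refine ⟨a.support.map ⟨_, hinj⟩, fun c hc => ?_, ?_⟩
  · by_cases h : ∃ ω, c = Finsupp.single ω 1
    · obtain ⟨ω, rfl⟩ := h
      have hω : ω ∉ a.support := fun hω => hc (Finset.mem_map_of_mem ⟨_, hinj⟩ hω)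
      rw [monomialValue_single_one, Finsupp.notMem_support_iff.mp hω, zero_smul]
    · rw [seriesCoeff_formalCombination_of_ne (fun ω h' => h ⟨ω, h'⟩), smul_zero]
  · rw [Finset.sum_map]
    simp only [Function.Embedding.coeFn_mk, monomialValue_single_one,
      seriesCoeff_formalCombination_single]
    simp [linearCombination, LinearMap.sum_apply]

/-- Evaluating the formal expansion of `f` at scalars `a` amounts to substituting
`x ↦ ∑_ω a_ω x_ω`. -/
theorem evaluatesTo_expansion (a : Ω →₀ k) {n : ℕ} (f : freeOperad M n) :
    EvaluatesTo a ((expansion Ω).toFun n f)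
      ((freeLift (linearCombination a (replicaGen M))).toFun n f) := by
  obtain ⟨t, rfl⟩ := freeMk_surj f
  -- On a representative both morphisms are `freeEval`, so the claim follows by induction on the
  -- formal expression, each constructor being matched by a closure property of `EvaluatesTo`.
  change EvaluatesTo a (freeEval (formalCombination M Ω) t)
    (freeEval (linearCombination a (replicaGen M)) t)
  induction t with
  | gen x => exact evaluatesTo_formalCombination a x
  | one => exact EvaluatesTo.one _
  | gamma n f g ihf ihg => exact ihf.gamma ihg
  | relabel e t ih =>
    exact ih.map ((freeOperad (replicas M Ω)).toSModule.relabel e)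
      fun c => seriesCoeff_relabel c e _
  | zero => exact EvaluatesTo.zero _
  | add s t ihs iht => exact ihs.add iht
  | smul c t ih =>
    exact ih.map (c • LinearMap.id) fun d =>
      (seriesCoeff d).map_smul c (freeEval (formalCombination M Ω) t)

/-- Each internal vertex contributes exactly one factor `λ_ω`, and degrees add under grafting, so a
tree with `m` vertices expands into terms of degree `m` only. The trivial tree gives the constant
series. -/
theorem quasipolarization_treeMonomial_eq_zero {m n : ℕ} {t : freeOperad M n}
    (ht : IsTreeMonomial m t) (c : Ω →₀ ℕ) (hc : c.degree ≠ m) : quasipolarization c t = 0 := by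
  classical
  induction ht generalizing c with
  | trivial =>
    have h : (expansion Ω).toFun 1 (freeOperad M).one = seriesOne (freeOperad (replicas M Ω)) Ω :=
      (expansion Ω).map_one
    rw [quasipolarization, h, seriesCoeff_one, if_neg]
    rintro rfl
    exact hc (map_zero _)
  | graft n m x t ht e ih =>
    rw [quasipolarization, (expansion Ω).map_relabel, (expansion Ω).map_gamma]
    refine (seriesCoeff_relabel c e _).trans ?_
    refine (congrArg _ ?_).trans (map_zero _)
    refine (seriesCoeff_gamma n c _ _).trans (Finset.sum_eq_zero fun p hp => ?_)
    rw [mem_exponentSplittings] at hp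
    -- The exponent of the root vertex must have this form, of degree one, or its coefficient
    -- vanishes. If it has this form and the total degree is wrong, some branch has the wrong degree
    -- and vanishes by induction.
    by_cases h : ∃ ω, p none = Finsupp.single ω 1
    · obtain ⟨ω, hω⟩ := h
      obtain ⟨i, hi⟩ : ∃ i, (p (some i)).degree ≠ m i := by
        by_contra! hcon
        apply hc
        rw [← hp, map_add, map_sum, hω, Finsupp.degree_single]
        simp only [hcon]
      exact MultilinearMap.map_coord_zero _ i (ih i _ hi)
    · have h0 : seriesCoeff (p none) ((expansion Ω).toFun _ ((freeGen M).toFun _ x)) = 0 :=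
        seriesCoeff_formalCombination_of_ne (fun ω h' => h ⟨ω, h'⟩) x
      rw [h0, map_zero, zero_apply]

/-- Taking the coefficient at `c` is linear in `f`, so its kernel contains the span of the trees
that it kills. -/
theorem quasipolarization_eq_zero {m n : ℕ} {f : freeOperad M n} (hf : f ∈ weightPart M m n)
    (c : Ω →₀ ℕ) (hc : c.degree ≠ m) : quasipolarization c f = 0 := by
  have h : weightPart M m n ≤
      LinearMap.ker ((seriesCoeff c).comp ((expansion (M := M) Ω).toFun n)) :=
    Submodule.span_le.mpr fun t ht => quasipolarization_treeMonomial_eq_zero ht c hc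
  exact h hf

end Quasipolarization

/-! ## Linearly compatible algebras -/

section Compatible

variable {k : Type u} [Field k] {M : SModule.{u, v} k} {Ω : Type w}

/-- The morphism `⨁ M_ω → N` with components `μ_ω`. -/
noncomputable def replicasDesc {N : SModule.{u, x} k} (μ : Ω → SModuleHom M N) :
    SModuleHom (replicas M Ω) N where
  toFun n := Finsupp.lsum k fun ω => (μ ω).toFun n
  map_act n σ x := by
    -- Both sides are linear in `x`, so it suffices to compare them on the elements `x_ω`.
    refine LinearMap.congr_fun (f := (Finsupp.lsum k fun ω => (μ ω).toFun n).comp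
      (Finsupp.mapRange.linearMap (M.act n σ)))
      (g := (N.act n σ).comp (Finsupp.lsum k fun ω => (μ ω).toFun n)) ?_ x
    ext ω x
    simp [(μ ω).map_act]

theorem replicasDesc_incl {N : SModule.{u, x} k} (μ : Ω → SModuleHom M N) (ω : Ω) {n : ℕ}
    (x : M n) : (replicasDesc μ).toFun n ((replicaIncl M ω).toFun n x) = (μ ω).toFun n x := by
  change Finsupp.lsum k (fun ω => (μ ω).toFun n) (Finsupp.single ω x) = _
  simp

/-- A polynomial over an infinite field, with vector coefficients, that vanishes on all scalars has
zero coefficients. -/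
theorem coeff_eq_zero_of_forall_sum_monomialValue_eq_zero [Infinite k] {W : Type x}
    [AddCommGroup W] [Module k W] (s : Finset (Ω →₀ ℕ)) (y : (Ω →₀ ℕ) → W)
    (h : ∀ b : Ω → k, ∑ c ∈ s, monomialValue b c • y c = 0) {c : Ω →₀ ℕ} (hc : c ∈ s) :
    y c = 0 := by
  classical
  -- Linear functionals separate the points of a vector space, which reduces the claim to scalar
  -- coefficients. There a polynomial over an infinite field is determined by its values, in any
  -- number of variables.
  refine (Module.forall_dual_apply_eq_zero_iff k _).mp fun φ => ?_
  have hp : ∑ d ∈ s, MvPolynomial.monomial d (φ (y d)) = 0 := by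
    refine MvPolynomial.funext fun b => ?_
    have hb := congrArg φ (h b)
    simp only [map_sum, map_smul, smul_eq_mul, map_zero] at hb
    simp only [map_sum, MvPolynomial.eval_monomial, map_zero, ← hb]
    exact Finset.sum_congr rfl fun d _ => mul_comm _ _
  have hcoeff := congrArg (MvPolynomial.coeff c) hp
  simpa [MvPolynomial.coeff_sum, MvPolynomial.coeff_monomial, hc] using hcoeff

/-- The expansion formula `f(∑ a_ω μ_ω) = ∑_c a^c f_c(μ)` for homogeneous `f`, as a sum over any
finite set of exponents that contains all those contributing. -/
theorem freeLift_linearCombination {Q : SymOperad.{u, x} k} (μ : Ω → SModuleHom M Q.toSModule)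
    (a : Ω →₀ k) {n m : ℕ} {f : freeOperad M n} (hf : f ∈ weightPart M m n) {S : Finset Ω}
    [DecidableEq Ω] (hS : a.support ⊆ S) :
    (freeLift (linearCombination a μ)).toFun n f = ∑ c ∈ S.finsuppAntidiag m,
      monomialValue a c • (freeLift (replicasDesc μ)).toFun n (quasipolarization c f) := by
  -- Substituting `∑ a_ω μ_ω` means substituting `∑ a_ω x_ω` inside the free operad and then sending
  -- `x_ω` to `μ_ω(x)`. Only the former step has to be compared with the formal expansion.
  have hcomp : freeLift (linearCombination a μ) = OperadHom.comp (freeLift (replicasDesc μ))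
      (freeLift (linearCombination a (replicaGen M))) := by
    refine free_hom_ext fun l x => ?_
    change (∑ ω ∈ a.support, a ω • (μ ω).toFun l) x = (freeLift (replicasDesc μ)).toFun l
      ((∑ ω ∈ a.support, a ω • (replicaGen M ω).toFun l) x)
    simp only [LinearMap.sum_apply, LinearMap.smul_apply, map_sum, map_smul]
    exact Finset.sum_congr rfl fun ω _ => congrArg _ (replicasDesc_incl μ ω x).symm
  rw [hcomp]
  change (freeLift (replicasDesc μ)).toFun n
    ((freeLift (linearCombination a (replicaGen M))).toFun n f) = _
  rw [← (evaluatesTo_expansion a f).sum_eq (s := S.finsuppAntidiag m), map_sum]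
  · simp only [map_smul]
    rfl
  · intro c hc
    -- An exponent outside the chosen set either has the wrong degree, and then its coefficient is
    -- zero, or involves a variable outside `S`, at which `a` vanishes.
    by_cases hdeg : c.degree = m
    · obtain ⟨ω, hω, hωS⟩ : ∃ ω ∈ c.support, ω ∉ S := by
        by_contra! hcon
        refine hc (Finset.mem_finsuppAntidiag.mpr ⟨?_, hcon⟩)
        rw [← hdeg]
        exact (Finset.sum_subset hcon fun ω _ h => Finsupp.notMem_support_iff.mp h).symm
      rw [monomialValue_eq_zero hω (Finsupp.notMem_support_iff.mp fun h => hωS (hS h)), zero_smul]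
    · have h0 : seriesCoeff c ((expansion Ω).toFun n f) = 0 := quasipolarization_eq_zero hf c hdeg
      rw [h0, smul_zero]

/-- This makes each single `μ ω` one of the linear combinations, so the first clause of
compatibility follows from the second. -/
theorem linearCombination_single {N : SModule.{u, x} k} (μ : Ω → SModuleHom M N) (ω : Ω) :
    linearCombination (Finsupp.single ω (1 : k)) μ = μ ω := by
  refine SModuleHom.ext (funext fun n => ?_)
  change ∑ ω' ∈ (Finsupp.single ω (1 : k)).support,
    Finsupp.single ω (1 : k) ω' • (μ ω').toFun n = _
  rw [Finsupp.support_single _ one_ne_zero, Finset.sum_singleton, Finsupp.single_eq_same,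
    one_smul]

/-! ### Algebra structures as vanishing conditions -/

variable {R : ∀ n, Set (freeOperad M n)} {V : Type x} [AddCommGroup V] [Module k V]

theorem isAlgebraStructure_iff (ν : SModuleHom M (endOperad k V).toSModule) :
    IsAlgebraStructure R ν ↔ ∀ n, ∀ r ∈ R n, (freeLift ν).toFun n r = 0 :=
  exists_presentedOperad_hom_iff ν

/-- The kernel of `freeLift ν` is an operadic ideal. If it contains the homogeneous relations, it
contains the ideal they generate, which by `hR` is all of `⟨R⟩`. -/
theorem isAlgebraStructure_iff_of_isLocallyHomogeneous (hR : IsLocallyHomogeneous R)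
    (ν : SModuleHom M (endOperad k V).toSModule) :
    IsAlgebraStructure R ν ↔
      ∀ n, ∀ r ∈ R n, IsHomogeneousRel r → (freeLift ν).toFun n r = 0 := by
  rw [isAlgebraStructure_iff]
  refine ⟨fun h n r hr _ => h n r hr, fun h n r hr => ?_⟩
  have hr' := subset_operadIdealSpan R n hr
  rw [show operadIdealSpan R = _ from hR] at hr'
  exact (OperadHom.mem_ker _).mp (operadIdealSpan_le
    (fun l q hq => (OperadHom.mem_ker (freeLift ν)).mpr (h l q hq.1 hq.2)) n hr')

/-- The projection onto the quotient is surjective, the free operad is generated by `⨁ M_ω`, and the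
`x_ω` span this sum; so the values at the `x_ω` determine `ρ`. -/
theorem replicatedOperations_injective :
    Function.Injective (fun ρ : OperadHom (linOperad Ω R) (endOperad k V) =>
      replicatedOperations ρ) := by
  intro ρ ρ' h
  refine OperadHom.quotient_hom_ext (free_hom_ext fun n y => ?_)
  refine LinearMap.congr_fun (f := (ρ.toFun n).comp ((presentedGen (linRelations Ω R)).toFun n))
    (g := (ρ'.toFun n).comp ((presentedGen (linRelations Ω R)).toFun n)) ?_ y
  exact Finsupp.lhom_ext fun ω x =>
    congrArg (fun μ : Ω → SModuleHom M (endOperad k V).toSModule => (μ ω).toFun n x) h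

/-- By the universal property of the direct sum, a family `μ` is the same as one morphism
`replicasDesc μ` on `⨁ M_ω`. The criterion for presented operads then applies to it. -/
theorem exists_replicatedOperations_eq_iff (μ : Ω → SModuleHom M (endOperad k V).toSModule) :
    (∃ ρ : OperadHom (linOperad Ω R) (endOperad k V), replicatedOperations ρ = μ) ↔
      ∀ n, ∀ q ∈ linRelations Ω R n, (freeLift (replicasDesc μ)).toFun n q = 0 := by
  rw [← exists_presentedOperad_hom_iff]
  refine exists_congr fun ρ => ⟨?_, fun h => ?_⟩
  · rintro rfl n y
    refine LinearMap.congr_fun (f := (ρ.toFun n).comp ((presentedGen (linRelations Ω R)).toFun n))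
      (g := (replicasDesc (replicatedOperations ρ)).toFun n) ?_ y
    exact Finsupp.lhom_ext fun ω x => (replicasDesc_incl (replicatedOperations ρ) ω x).symm
  · exact funext fun ω => SModuleHom.ext (funext fun n => LinearMap.ext fun x =>
      (h n ((replicaIncl M ω).toFun n x)).trans (replicasDesc_incl μ ω x))

/-- The expansion formula is read in both directions. Left to right, the infinite field separates
the coefficients `r_c`. Right to left, local homogeneity is needed, since only homogeneous relations
have their quasipolarizations imposed. -/
theorem isLinearlyCompatible_iff [Infinite k] (hR : IsLocallyHomogeneous R)
    (μ : Ω → SModuleHom M (endOperad k V).toSModule) :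
    IsLinearlyCompatible R μ ↔
      ∀ n, ∀ q ∈ linRelations Ω R n, (freeLift (replicasDesc μ)).toFun n q = 0 := by
  classical
  constructor
  · rintro ⟨-, hμ⟩ n q ⟨r, m, c, hr, hrm, hc, rfl⟩
    -- The variables are restricted to the finite support of the given `c`. The exponents of degree
    -- `m` supported there form a finite set that still contains `c`.
    refine coeff_eq_zero_of_forall_sum_monomialValue_eq_zero (k := k)
      (c.support.finsuppAntidiag m)
      (fun d => (freeLift (replicasDesc μ)).toFun n (quasipolarization d r)) (fun b => ?_)
      (Finset.mem_finsuppAntidiag.mpr ⟨hc, subset_rfl⟩)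
    -- Compatibility speaks only of finitely supported scalars, so the arbitrary `b` is cut off
    -- outside `c.support`.
    have h := (isAlgebraStructure_iff _).mp
      (hμ (Finsupp.onFinset c.support (fun ω => if ω ∈ c.support then b ω else 0)
        fun ω hω => by_contra fun h => hω (if_neg h))) n r hr
    rw [freeLift_linearCombination μ _ hrm Finsupp.support_onFinset_subset] at h
    rw [← h]
    -- Every exponent `d` in the sum is supported in `c.support`, so the cut-off does not change the
    -- value of its monomial.
    refine Finset.sum_congr rfl fun d hd => congrArg (· • _) (Finset.prod_congr rfl fun ω hω => ?_)
    simp only [Finsupp.onFinset_apply, if_pos ((Finset.mem_finsuppAntidiag.mp hd).2 hω)]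
  · intro h
    have hlin : ∀ a : Ω →₀ k, IsAlgebraStructure R (linearCombination a μ) := by
      intro a
      rw [isAlgebraStructure_iff_of_isLocallyHomogeneous hR]
      rintro n r hr ⟨m, hm⟩
      -- Each exponent in this sum has degree `m`, the weight of `r`, so the corresponding `r_c` is
      -- one of the imposed relations.
      rw [freeLift_linearCombination μ a hm subset_rfl]
      refine Finset.sum_eq_zero fun c hc => ?_
      obtain ⟨hcm, hcs⟩ := Finset.mem_finsuppAntidiag.mp hc
      have hdeg : c.degree = m := by
        rw [← hcm]
        exact Finset.sum_subset hcs fun ω _ h => Finsupp.notMem_support_iff.mp h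
      rw [h n _ ⟨r, m, c, hr, hm, hdeg, rfl⟩, smul_zero]
    exact ⟨fun ω => linearCombination_single (k := k) μ ω ▸ hlin (Finsupp.single ω 1), hlin⟩

end Compatible

theorem mainTheorem5 {k : Type u} [Field k] [CharZero k] (Ω : Type w) [Nonempty Ω]
    (M : SModule.{u, v} k) (hM : M.IsReduced) (R : ∀ n, Set (freeOperad M n))
    (hR : IsLocallyHomogeneous R) (V : Type x) [AddCommGroup V] [Module k V] :
    Function.Injective (fun ρ : OperadHom (linOperad Ω R) (endOperad k V) =>
        replicatedOperations ρ) ∧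
      ∀ μ : Ω → SModuleHom M (endOperad k V).toSModule,
        (∃ ρ : OperadHom (linOperad Ω R) (endOperad k V), replicatedOperations ρ = μ) ↔
          IsLinearlyCompatible R μ := by
  have : Infinite k := Infinite.of_injective _ (Nat.cast_injective (R := k))
  exact ⟨replicatedOperations_injective, fun μ =>
    (exists_replicatedOperations_eq_iff μ).trans (isLinearlyCompatible_iff hR μ).symm⟩
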